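/- Let $J_\nu$, $Y_\nu$ be the Bessel functions of the first and second kind and $K_\nu$ the modified Bessel function of the second kind. For real $\nu$ and $n\ge 0$ put $$a_n(\nu)=\frac{(4\nu^2-1^2)(4\nu^2-3^2)\cdots(4\nu^2-(2n-1)^2)}{8^n\, n!},\qquad a_0(\nu)=1 .$$ For $z>0$ and $\omega=z-\frac{\pi}{2}\nu-\frac{\pi}{4}$, let the remainders $R_N^{(K)}(z,\nu)$ and $R_N^{(J)}(z,\nu)$, $N\ge 0$, be defined by $$K_\nu(z)=\Big(\frac{\pi}{2z}\Big)^{\frac12}e^{-z}\Big(\sum_{n=0}^{N-1}\frac{a_n(\nu)}{z^n}+R_N^{(K)}(z,\nu)\Big)$$ and by the requirement that, for all integers $N,M\ge 0$, $$J_\nu(z)=\Big(\frac{2}{\pi z}\Big)^{\frac12}\big(\cos\omega\; P_N-\sin\omega\; Q_M\big),\qquad Y_\nu(z)=\Big(\frac{2}{\pi z}\Big)^{\frac12}\big(\sin\omega\; P_N+\cos\omega\; Q_M\big),$$ where $$P_N=\sum_{n=0}^{N-1}(-1)^n\frac{a_{2n}(\nu)}{z^{2n}}+R_{2N}^{(J)}(z,\nu),\qquad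 Q_M=\sum_{m=0}^{M-1}(-1)^m\frac{a_{2m+1}(\nu)}{z^{2m+1}}-R_{2M+1}^{(J)}(z,\nu).$$ Let $\Lambda_p(w)=w^pe^w\Gamma(1-p,w)$, where $\Gamma(\cdot,\cdot)$ is the (upper) incomplete gamma function and all branches are principal for $|\arg w|<\pi$, and let $\Pi_p(w)=\frac12\big(\Lambda_p(we^{\pi i/2})+\Lambda_p(we^{-\pi i/2})\big)$. For integers $0\le M<N$ define $R_{N,M}^{(K)}$ and $R_{N,M}^{(J)}$ by $$R_N^{(K)}(z,\nu)=(-1)^N\frac{\cos(\pi\nu)}{2^N\pi}\frac1{z^N}\sum_{m=0}^{M-1}2^ma_m(\nu)\Gamma(N-m)\Lambda_{N-m}(2z)+R_{N,M}^{(K)}(z,\nu),$$ $$R_N^{(J)}(z,\nu)=(-1)^{\lfloor N/2\rfloor}\frac{\cos(\pi\nu)}{2^N\pi}\frac1{z^N}\sum_{m=0}^{M-1}2^ma_m(\nu)\Gamma(N-m)\Pi_{N-m}(2z)+R_{N,M}^{(J)}(z,\nu).$$ **Theorem.** Let $N$ and $M$ be non-negative integers with $M<N$, let $z>0$, and let $\nu$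 be a real number with $|\nu|<M+\frac12$. Then $$R_{N,M}^{(K)}(z,\nu)=(-1)^N\frac{\cos(\pi\nu)}{2^N\pi}\frac1{z^N}2^Ma_M(\nu)\Gamma(N-M)\Lambda_{N-M}(2z)\,\Theta_{N,M}^{(K)}(z,\nu)$$ and $$R_{N,M}^{(J)}(z,\nu)=(-1)^{\lfloor N/2\rfloor}\frac{\cos(\pi\nu)}{2^N\pi}\frac1{z^N}2^Ma_M(\nu)\Gamma(N-M)\Pi_{N-M}(2z)\,\Theta_{N,M}^{(J)}(z,\nu),$$ where $0<\Theta_{N,M}^{(K)}(z,\nu)<1$ and $0<\Theta_{N,M}^{(J)}(z,\nu)<1$ are suitable numbers depending on $z$, $\nu$, $N$ and $M$. -/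

import Mathlib

noncomputable section

namespace BesselReexpansion

/-- The Bessel function of the first kind `J_ν(x)`, `x > 0`, `ν` real, by its power series
`∑ (-1)^k (x/2)^(2k+ν) / (k! Γ(ν+k+1))`. Mathlib's `Real.Gamma` vanishes at the poles of the gamma
function, so that the terms in which `1 / Γ(ν+k+1)` has to be read as `0` are indeed `0`. -/
def besselJ (ν x : ℝ) : ℝ :=
  ∑' k : ℕ, (-1 : ℝ) ^ k / ((k.factorial : ℝ) * Real.Gamma (ν + k + 1)) * (x / 2) ^ (2 * (k : ℝ) + ν)

open Classical in
/-- The Bessel function of the second kind `Y_ν(x)`, `x > 0`, `ν` real: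
`(J_ν(x) cos(πν) - J_{-ν}(x)) / sin(πν)`, with the limiting value if `ν` is an integer. -/
def besselY (ν x : ℝ) : ℝ :=
  if ∃ n : ℤ, (n : ℝ) = ν then
    Filter.limUnder (nhdsWithin ν {ν}ᶜ) fun μ : ℝ =>
      (besselJ μ x * Real.cos (Real.pi * μ) - besselJ (-μ) x) / Real.sin (Real.pi * μ)
  else
    (besselJ ν x * Real.cos (Real.pi * ν) - besselJ (-ν) x) / Real.sin (Real.pi * ν)

/-- The modified Bessel function of the second kind `K_ν(x)`, `x > 0`, `ν` real:
`K_ν(x) = ∫_0^∞ exp(-x cosh t) cosh(νt) dt`. -/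
def besselK (ν x : ℝ) : ℝ :=
  ∫ t in Set.Ioi (0 : ℝ), Real.exp (-x * Real.cosh t) * Real.cosh (ν * t)

/-- The coefficients
`a_n(ν) = (4ν² - 1²)(4ν² - 3²)⋯(4ν² - (2n-1)²) / (8^n n!)` of the large-argument expansions. -/
def coeffA (n : ℕ) (ν : ℝ) : ℝ :=
  (∏ k ∈ Finset.range n, (4 * ν ^ 2 - (2 * (k : ℝ) + 1) ^ 2)) / (8 ^ n * (n.factorial : ℝ))

/-- The phase `ω = z - πν/2 - π/4`. -/
def phase (z ν : ℝ) : ℝ := z - Real.pi / 2 * ν - Real.pi / 4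

/-- The remainder `R_N^{(K)}(z,ν)`, `z > 0`, defined by
`K_ν(z) = (π/(2z))^{1/2} e^{-z} (∑_{n<N} a_n(ν)/z^n + R_N^{(K)}(z,ν))`. -/
def remainderK (N : ℕ) (z ν : ℝ) : ℝ :=
  besselK ν z / (Real.sqrt (Real.pi / (2 * z)) * Real.exp (-z))
    - ∑ n ∈ Finset.range N, coeffA n ν / z ^ n

/-- The remainders `R_N^{(J)}(z,ν)`, `z > 0`. They are the quantities for which
`J_ν(z) = (2/(πz))^{1/2} (cos ω (∑_{n<N} (-1)^n a_{2n}(ν)/z^{2n} + R_{2N}^{(J)}(z,ν))`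
`  - sin ω (∑_{m<M} (-1)^m a_{2m+1}(ν)/z^{2m+1} - R_{2M+1}^{(J)}(z,ν)))`
and
`Y_ν(z) = (2/(πz))^{1/2} (sin ω (∑_{n<N} (-1)^n a_{2n}(ν)/z^{2n} + R_{2N}^{(J)}(z,ν))`
`  + cos ω (∑_{m<M} (-1)^m a_{2m+1}(ν)/z^{2m+1} - R_{2M+1}^{(J)}(z,ν)))`
hold for all `N` and `M` (see `besselJ_eq` and `besselY_eq`); these two linear equations, whose
determinant is not zero, determine them. -/
def remainderJ (N : ℕ) (z ν : ℝ) : ℝ :=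
  if Even N then
    Real.sqrt (Real.pi * z / 2)
        * (besselJ ν z * Real.cos (phase z ν) + besselY ν z * Real.sin (phase z ν))
      - ∑ n ∈ Finset.range (N / 2), (-1 : ℝ) ^ n * coeffA (2 * n) ν / z ^ (2 * n)
  else
    (∑ m ∈ Finset.range (N / 2), (-1 : ℝ) ^ m * coeffA (2 * m + 1) ν / z ^ (2 * m + 1))
      - Real.sqrt (Real.pi * z / 2)
        * (besselY ν z * Real.cos (phase z ν) - besselJ ν z * Real.sin (phase z ν))

theorem sqrt_mul_sqrt_aux {z : ℝ} (hz : 0 < z) :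
    Real.sqrt (2 / (Real.pi * z)) * Real.sqrt (Real.pi * z / 2) = 1 := by
  have hpi := Real.pi_pos
  rw [← Real.sqrt_mul (by positivity)]
  have h : 2 / (Real.pi * z) * (Real.pi * z / 2) = 1 := by field_simp
  rw [h, Real.sqrt_one]

theorem besselK_eq (N : ℕ) {z : ℝ} (hz : 0 < z) (ν : ℝ) :
    besselK ν z = Real.sqrt (Real.pi / (2 * z)) * Real.exp (-z)
      * ((∑ n ∈ Finset.range N, coeffA n ν / z ^ n) + remainderK N z ν) := by
  have hpi := Real.pi_pos
  have h : Real.sqrt (Real.pi / (2 * z)) * Real.exp (-z) ≠ 0 := by positivity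
  unfold remainderK
  rw [add_sub_cancel, mul_div_cancel₀ _ h]

theorem besselJ_eq (N M : ℕ) {z : ℝ} (hz : 0 < z) (ν : ℝ) :
    besselJ ν z = Real.sqrt (2 / (Real.pi * z)) *
      (Real.cos (phase z ν) *
          ((∑ n ∈ Finset.range N, (-1 : ℝ) ^ n * coeffA (2 * n) ν / z ^ (2 * n))
            + remainderJ (2 * N) z ν)
        - Real.sin (phase z ν) *
          ((∑ m ∈ Finset.range M, (-1 : ℝ) ^ m * coeffA (2 * m + 1) ν / z ^ (2 * m + 1))
            - remainderJ (2 * M + 1) z ν)) := by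
  have e1 : 2 * N / 2 = N := by omega
  have e2 : (2 * M + 1) / 2 = M := by omega
  have e3 : ¬ Even (2 * M + 1) := by simp
  have e4 : Even (2 * N) := by simp
  simp only [remainderJ, if_pos e4, if_neg e3, e1, e2]
  have h1 := sqrt_mul_sqrt_aux hz
  have h2 := Real.sin_sq_add_cos_sq (phase z ν)
  linear_combination (-(besselJ ν z)) * h1
    - Real.sqrt (2 / (Real.pi * z)) * Real.sqrt (Real.pi * z / 2) * besselJ ν z * h2

theorem besselY_eq (N M : ℕ) {z : ℝ} (hz : 0 < z) (ν : ℝ) :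
    besselY ν z = Real.sqrt (2 / (Real.pi * z)) *
      (Real.sin (phase z ν) *
          ((∑ n ∈ Finset.range N, (-1 : ℝ) ^ n * coeffA (2 * n) ν / z ^ (2 * n))
            + remainderJ (2 * N) z ν)
        + Real.cos (phase z ν) *
          ((∑ m ∈ Finset.range M, (-1 : ℝ) ^ m * coeffA (2 * m + 1) ν / z ^ (2 * m + 1))
            - remainderJ (2 * M + 1) z ν)) := by
  have e1 : 2 * N / 2 = N := by omega
  have e2 : (2 * M + 1) / 2 = M := by omega
  have e3 : ¬ Even (2 * M + 1) := by simp
  have e4 : Even (2 * N) := by simp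
  simp only [remainderJ, if_pos e4, if_neg e3, e1, e2]
  have h1 := sqrt_mul_sqrt_aux hz
  have h2 := Real.sin_sq_add_cos_sq (phase z ν)
  linear_combination (-(besselY ν z)) * h1
    - Real.sqrt (2 / (Real.pi * z)) * Real.sqrt (Real.pi * z / 2) * besselY ν z * h2

/-- The (upper) incomplete gamma function `Γ(a,w) = ∫_w^∞ t^{a-1} e^{-t} dt` for `|arg w| < π`,
the path of integration being the horizontal half-line `t = w + s`, `s > 0`, which does not meet
the cut `(-∞, 0]`; principal values. -/
def incompleteGamma (a w : ℂ) : ℂ :=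
  ∫ s in Set.Ioi (0 : ℝ), (w + (s : ℂ)) ^ (a - 1) * Complex.exp (-(w + (s : ℂ)))

/-- The basic terminant `Λ_p(w) = w^p e^w Γ(1-p,w)`, `|arg w| < π`. -/
def terminantLambda (p w : ℂ) : ℂ := w ^ p * Complex.exp w * incompleteGamma (1 - p) w

/-- The basic terminant `Π_p(w) = (Λ_p(w e^{πi/2}) + Λ_p(w e^{-πi/2})) / 2`, `|arg w| < π/2`. -/
def terminantPi (p w : ℂ) : ℂ :=
  (terminantLambda p (w * Complex.I) + terminantLambda p (w * (-Complex.I))) / 2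

/-- The `m`-th term of the re-expansion of `R_N^{(K)}(z,ν)`:
`(-1)^N cos(πν)/(2^N π) z^{-N} 2^m a_m(ν) Γ(N-m) Λ_{N-m}(2z)`. -/
def termK (N m : ℕ) (z ν : ℝ) : ℂ :=
  (((-1 : ℝ) ^ N * (Real.cos (Real.pi * ν) / (2 ^ N * Real.pi)) * (1 / z ^ N)
      * (2 ^ m * coeffA m ν * Real.Gamma ((N : ℝ) - m)) : ℝ) : ℂ)
    * terminantLambda ((N : ℂ) - m) (2 * (z : ℂ))

/-- The `m`-th term of the re-expansion of `R_N^{(J)}(z,ν)`: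
`(-1)^⌊N/2⌋ cos(πν)/(2^N π) z^{-N} 2^m a_m(ν) Γ(N-m) Π_{N-m}(2z)`. -/
def termJ (N m : ℕ) (z ν : ℝ) : ℂ :=
  (((-1 : ℝ) ^ (N / 2) * (Real.cos (Real.pi * ν) / (2 ^ N * Real.pi)) * (1 / z ^ N)
      * (2 ^ m * coeffA m ν * Real.Gamma ((N : ℝ) - m)) : ℝ) : ℂ)
    * terminantPi ((N : ℂ) - m) (2 * (z : ℂ))

/-- The remainder `R_{N,M}^{(K)}(z,ν)` of the re-expansion of `R_N^{(K)}(z,ν)` after `M` terms. -/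
def reexpRemainderK (N M : ℕ) (z ν : ℝ) : ℂ :=
  (remainderK N z ν : ℂ) - ∑ m ∈ Finset.range M, termK N m z ν

/-- The remainder `R_{N,M}^{(J)}(z,ν)` of the re-expansion of `R_N^{(J)}(z,ν)` after `M` terms. -/
def reexpRemainderJ (N M : ℕ) (z ν : ℝ) : ℂ :=
  (remainderJ N z ν : ℂ) - ∑ m ∈ Finset.range M, termJ N m z ν

end BesselReexpansion

end

/-!
Write `f(t) = (2t/π)^(1/2) e^t K_ν(t)`, the function expanded in powers of `1/t`. The theorem rests
on the fact that the remainders are integral transforms of `K_ν` itself: for `|ν| < N + 1/2`,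

* `R_N^{(K)}(z,ν) = (-1)^N cos(πν)/π z^(-N) ∫_0^∞ t^(N-1) e^(-2t) f(t) / (1 + t/z) dt`
  (`remainderK_eq`),
* `R_N^{(J)}(z,ν) = (-1)^⌊N/2⌋ cos(πν)/π z^(-N) ∫_0^∞ t^(N-1) e^(-2t) f(t) / (1 + (t/z)²) dt`
  (`remainderJ_eq`).

Since the kernel `1 / (1 + s/t)` lies between `0` and `1` and `K_ν` is positive, the first formula
shows that `R_M^{(K)}(t,ν) = a_M(ν) t^(-M) θ(t)` with `0 < θ(t) < 1` if `|ν| < M + 1/2`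
(`exists_remainderK_eq`). Inserting `f(t) = ∑_{m<M} a_m(ν) t^(-m) + R_M^{(K)}(t,ν)` into the two
formulas produces the terms of the re-expansions, because
`Γ(p) Λ_p(w) = ∫_0^∞ t^(p-1) e^(-t) / (1 + t/w) dt` (`factorial_mul_terminantLambda`), and leaves
the next term multiplied by the average of `θ` with respect to a positive weight
(`exists_reexpansion`).

The first formula is proved for `N = 0` and `|ν| < 1/2` from a Laplace integral for `K_ν`
(`hasInt_laplaceK`): its factor `(1+y)^(ν-1/2)` is a Stieltjes transform, and a substitution turns
the resulting double integral into a Stieltjes transform of the same Laplace integral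
(`hasInt_stieltjes_besselK`). The moments of the density are the coefficients `a_n(ν)`, which gives
the formula for every `N`; both sides are analytic in `ν`, which extends it to `|ν| < N + 1/2`.

For the second formula, `K_ν` is expressed by the power series of `I_ν` and `I_{-ν}`
(`besselK_eq_besselSReal`). The difference of the two sides of that identity satisfies, together
with the one for `1 - ν`, a linear differential system with integrable coefficients and vanishing
initial values. In this form the first formula continues analytically in `z` to the negative
imaginary axis, where the power series become those of `J_ν` and `J_{-ν}` and the integral splits
into the real and imaginary parts that belong to even and odd `N` (`hankel_eq`). Integer `ν` follow
by continuity in `ν`.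
-/

noncomputable section

namespace BesselReexpansion

open MeasureTheory Set Filter Topology

/-! ### Integrals over a half-line: Tonelli, substitutions, beta integral -/

/-- `HasInt s F c`: the real function `F` is integrable on `s` and its integral there is `c`. -/
def HasInt (s : Set ℝ) (F : ℝ → ℝ) (c : ℝ) : Prop :=
  IntegrableOn F s ∧ ∫ x in s, F x = c

theorem HasInt.congr {s : Set ℝ} (hs : MeasurableSet s) {F G : ℝ → ℝ} {c d : ℝ}
    (h : HasInt s F c) (hFG : ∀ x ∈ s, F x = G x) (hcd : c = d) : HasInt s G d :=
  ⟨h.1.congr_fun hFG hs, by rw [← setIntegral_congr_fun hs hFG, h.2, hcd]⟩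

theorem HasInt.const_mul {s : Set ℝ} {F : ℝ → ℝ} {c : ℝ} (h : HasInt s F c) (k : ℝ) :
    HasInt s (fun x => k * F x) (k * c) :=
  ⟨h.1.const_mul k, by rw [integral_const_mul, h.2]⟩

theorem HasInt.add {s : Set ℝ} {F G : ℝ → ℝ} {c d : ℝ} (h : HasInt s F c) (h' : HasInt s G d) :
    HasInt s (fun x => F x + G x) (c + d) :=
  ⟨h.1.add h'.1, by rw [integral_add h.1 h'.1, h.2, h'.2]⟩

theorem HasInt.sub {s : Set ℝ} {F G : ℝ → ℝ} {c d : ℝ} (h : HasInt s F c) (h' : HasInt s G d) :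
    HasInt s (fun x => F x - G x) (c - d) :=
  ⟨h.1.sub h'.1, by rw [integral_sub h.1 h'.1, h.2, h'.2]⟩

theorem HasInt.sum {s : Set ℝ} {ι : Type*} (t : Finset ι) {F : ι → ℝ → ℝ} {c : ι → ℝ}
    (h : ∀ i ∈ t, HasInt s (F i) (c i)) :
    HasInt s (fun x => ∑ i ∈ t, F i x) (∑ i ∈ t, c i) :=
  ⟨integrable_finsetSum t fun i hi => (h i hi).1, by
    rw [integral_finsetSum t fun i hi => (h i hi).1]
    exact Finset.sum_congr rfl fun i hi => (h i hi).2⟩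

theorem HasInt.unique {s : Set ℝ} {F : ℝ → ℝ} {c d : ℝ} (h : HasInt s F c) (h' : HasInt s F d) :
    c = d := h.2.symm.trans h'.2

/-- Tonelli's theorem: for a nonnegative function, integrability of one iterated integral implies
that of the other, with the same value. -/
theorem HasInt.tonelli {s t : Set ℝ} (hs : MeasurableSet s) (ht : MeasurableSet t)
    {f : ℝ → ℝ → ℝ} {g h : ℝ → ℝ} {c : ℝ} (hf : Measurable (Function.uncurry f))
    (hf0 : ∀ x ∈ s, ∀ y ∈ t, 0 ≤ f x y)
    (hg : ∀ x ∈ s, HasInt t (f x) (g x)) (hh : ∀ y ∈ t, HasInt s (fun x => f x y) (h y))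
    (hc : HasInt s g c) : HasInt t h c := by
  have hi : Integrable (Function.uncurry f) ((volume.restrict s).prod (volume.restrict t)) := by
    rw [integrable_prod_iff hf.aestronglyMeasurable]
    refine ⟨(ae_restrict_iff' hs).2 (Eventually.of_forall fun x hx => (hg x hx).1), ?_⟩
    refine hc.1.congr_fun (fun x hx => ?_) hs
    dsimp only [Function.uncurry]
    rw [← (hg x hx).2]
    exact setIntegral_congr_fun ht fun y hy => by
      simp only [Real.norm_eq_abs, abs_of_nonneg (hf0 x hx y hy)]
  constructor
  · exact IntegrableOn.congr_fun (f := fun y => ∫ x in s, f x y) hi.integral_prod_right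
      (fun y hy => (hh y hy).2) ht
  · rw [← hc.2, ← setIntegral_congr_fun ht fun y hy => (hh y hy).2,
      ← setIntegral_congr_fun hs fun x hx => (hg x hx).2]
    exact (integral_integral_swap hi).symm

/-- Change of variables along an injective map with nonnegative derivative. -/
theorem hasInt_image {s t : Set ℝ} (hs : MeasurableSet s) {φ φ' : ℝ → ℝ}
    (hφ : ∀ x ∈ s, HasDerivAt φ (φ' x) x) (hinj : InjOn φ s) (him : φ '' s = t)
    (h0 : ∀ x ∈ s, 0 ≤ φ' x) (F : ℝ → ℝ) (c : ℝ) :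
    HasInt t F c ↔ HasInt s (fun x => φ' x * F (φ x)) c := by
  subst him
  have e : ∀ x ∈ s, |φ' x| • F (φ x) = φ' x * F (φ x) := fun x hx => by
    rw [abs_of_nonneg (h0 x hx), smul_eq_mul]
  unfold HasInt
  rw [integrableOn_image_iff_integrableOn_abs_deriv_smul hs
      (fun x hx => (hφ x hx).hasDerivWithinAt) hinj,
    integral_image_eq_integral_abs_deriv_smul hs (fun x hx => (hφ x hx).hasDerivWithinAt) hinj,
    integrableOn_congr_fun e hs, setIntegral_congr_fun hs e]

theorem hasInt_mul_left {b : ℝ} (hb : 0 < b) (F : ℝ → ℝ) (c : ℝ) :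
    HasInt (Ioi 0) F c ↔ HasInt (Ioi 0) (fun x => b * F (b * x)) c := by
  refine hasInt_image (φ := fun x => b * x) measurableSet_Ioi (fun x _ => ?_) ?_ ?_
    (fun _ _ => hb.le) F c
  · simpa using (hasDerivAt_id x).const_mul b
  · exact (mul_right_injective₀ hb.ne').injOn
  · rw [image_mul_left_Ioi hb, mul_zero]

theorem hasInt_exp {b : ℝ} (hb : 0 < b) (F : ℝ → ℝ) (c : ℝ) :
    HasInt (Ioi 0) F c ↔
      HasInt univ (fun u => b * Real.exp u * F (b * Real.exp u)) c := by
  refine hasInt_image (φ := fun u => b * Real.exp u) MeasurableSet.univ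
    (fun x _ => (Real.hasDerivAt_exp x).const_mul b) ?_ ?_ (fun x _ => by positivity) F c
  · exact fun x _ y _ h => Real.exp_injective (mul_left_cancel₀ hb.ne' h)
  · ext y
    simp only [image_univ, mem_range, mem_Ioi]
    constructor
    · rintro ⟨x, rfl⟩; positivity
    · intro hy
      exact ⟨Real.log (y / b), by rw [Real.exp_log (by positivity)]; field_simp⟩

theorem hasInt_inv (F : ℝ → ℝ) (c : ℝ) :
    HasInt (Ioi 0) F c ↔ HasInt (Ioi 0) (fun x => (x ^ 2)⁻¹ * F x⁻¹) c := by
  unfold HasInt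
  have key := integrableOn_image_iff_integrableOn_abs_deriv_smul (s := Ioi (0 : ℝ))
    (f := fun x => x⁻¹) (f' := fun x => -(x ^ 2)⁻¹) measurableSet_Ioi
    (fun x hx => (hasDerivAt_inv (ne_of_gt hx)).hasDerivWithinAt) inv_injective.injOn F
  have key2 := integral_image_eq_integral_abs_deriv_smul (s := Ioi (0 : ℝ))
    (f := fun x => x⁻¹) (f' := fun x => -(x ^ 2)⁻¹) measurableSet_Ioi
    (fun x hx => (hasDerivAt_inv (ne_of_gt hx)).hasDerivWithinAt) inv_injective.injOn F
  have him : (fun x : ℝ => x⁻¹) '' Ioi 0 = Ioi 0 := by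
    rw [image_inv_eq_inv]
    ext x; simp
  have e : ∀ x : ℝ, |-(x ^ 2)⁻¹| • F x⁻¹ = (x ^ 2)⁻¹ * F x⁻¹ := fun x => by
    rw [abs_neg, abs_of_nonneg (by positivity), smul_eq_mul]
  rw [him] at key key2
  simp only [e] at key key2
  rw [key, key2]

/-- The substitution `v = y (1 + y)`. -/
theorem hasInt_mul_one_add (F : ℝ → ℝ) (c : ℝ) :
    HasInt (Ioi 0) F c ↔ HasInt (Ioi 0) (fun y => (1 + 2 * y) * F (y * (1 + y))) c := by
  refine hasInt_image (φ := fun y => y * (1 + y)) measurableSet_Ioi (fun x _ => ?_) ?_ ?_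
    (fun x hx => ?_) F c
  · have h := (hasDerivAt_id x).mul ((hasDerivAt_id x).const_add 1)
    exact h.congr_deriv (by simp only [id]; ring)
  · intro x hx y hy h
    simp only [mem_Ioi] at hx hy
    have h' : (x - y) * (1 + x + y) = 0 := by
      simp only at h; linear_combination h
    rcases mul_eq_zero.1 h' with h' | h'
    · linarith
    · linarith
  · ext v
    simp only [mem_image, mem_Ioi]
    constructor
    · rintro ⟨x, hx, rfl⟩; positivity
    · intro hv
      have h1 : Real.sqrt (1 + 4 * v) ^ 2 = 1 + 4 * v := Real.sq_sqrt (by linarith)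
      have h2 : 1 < Real.sqrt (1 + 4 * v) := by
        rw [Real.lt_sqrt (by norm_num)]; linarith
      exact ⟨(Real.sqrt (1 + 4 * v) - 1) / 2, by linarith, by linear_combination h1 / 4⟩
  · simp only [mem_Ioi] at hx; linarith

theorem hasInt_Gamma {p b : ℝ} (hp : 0 < p) (hb : 0 < b) :
    HasInt (Ioi 0) (fun t => t ^ (p - 1) * Real.exp (-(b * t))) (Real.Gamma p / b ^ p) := by
  constructor
  · have := integrableOn_rpow_mul_exp_neg_mul_rpow (p := 1) (s := p - 1) (by linarith) one_pos hb
    simpa using this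
  · rw [Real.integral_rpow_mul_exp_neg_mul_Ioi hp hb, Real.div_rpow zero_le_one hb.le,
      Real.one_rpow]
    ring

/-- The beta integral over a half-line. -/
theorem hasInt_beta {p q : ℝ} (hp : 0 < p) (hq : 0 < q) :
    HasInt (Ioi 0) (fun y => y ^ (p - 1) / (1 + y) ^ (p + q))
      (Real.Gamma p * Real.Gamma q / Real.Gamma (p + q)) := by
  have key : HasInt (Ioi 0) (fun y => Real.Gamma (p + q) * (y ^ (p - 1) / (1 + y) ^ (p + q)))
      (Real.Gamma p * Real.Gamma q) := by
    refine HasInt.tonelli (s := Ioi 0) measurableSet_Ioi measurableSet_Ioi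
      (f := fun t y => (t ^ (p + q - 1) * Real.exp (-t)) * (y ^ (p - 1) * Real.exp (-(t * y))))
      (g := fun t => Real.Gamma p * (t ^ (q - 1) * Real.exp (-(1 * t)))) ?_ ?_ ?_ ?_ ?_
    · unfold Function.uncurry; fun_prop
    · intro x hx y hy
      simp only [mem_Ioi] at hx hy
      positivity
    · intro t ht
      simp only [mem_Ioi] at ht
      refine ((hasInt_Gamma hp ht).const_mul (t ^ (p + q - 1) * Real.exp (-t))).congr
        measurableSet_Ioi (fun y _ => rfl) ?_
      rw [show p + q - 1 = (q - 1) + p by ring, Real.rpow_add ht]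
      field_simp
    · intro y hy
      simp only [mem_Ioi] at hy
      refine ((hasInt_Gamma (add_pos hp hq) (b := 1 + y) (by linarith)).const_mul
        (y ^ (p - 1))).congr measurableSet_Ioi (fun t _ => ?_) (by ring)
      rw [show -((1 + y) * t) = -t + -(t * y) by ring, Real.exp_add]
      ring
    · refine ((hasInt_Gamma hq one_pos).const_mul (Real.Gamma p)).congr measurableSet_Ioi
        (fun t _ => rfl) ?_
      simp
  refine (key.const_mul (Real.Gamma (p + q))⁻¹).congr measurableSet_Ioi (fun y _ => ?_) ?_
  · field_simp
  · field_simp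

/-! ### The integral `besselG` and the function `K_ν` -/

/-- The integral `∫_0^∞ exp(-t - x/t) t^(ν-1) dt`, `x > 0`; it equals `2 (z/2)^ν K_ν(z)` for
`x = z²/4`. -/
def besselG (ν x : ℝ) : ℝ := ∫ t in Ioi (0 : ℝ), Real.exp (-t - x / t) * t ^ (ν - 1)

theorem hasInt_besselG (ν : ℝ) {x : ℝ} (hx : 0 < x) :
    HasInt (Ioi 0) (fun t => Real.exp (-t - x / t) * t ^ (ν - 1)) (besselG ν x) := by
  refine ⟨?_, rfl⟩
  obtain ⟨m, hm⟩ := exists_nat_gt (-ν)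
  have hb := ((hasInt_Gamma (p := ν + m) (by linarith) one_pos).const_mul
    ((m.factorial : ℝ) / x ^ m)).1
  refine Integrable.mono' hb (by fun_prop) ?_
  refine (ae_restrict_iff' measurableSet_Ioi).2 (Eventually.of_forall fun t ht => ?_)
  simp only [mem_Ioi] at ht
  have h1 := Real.pow_div_factorial_le_exp (x / t) (by positivity) m
  rw [Real.norm_of_nonneg (by positivity), sub_eq_add_neg, Real.exp_add, Real.exp_neg (x / t),
    show ν + m - 1 = (ν - 1) + m by ring, Real.rpow_add ht, Real.rpow_natCast, one_mul]
  have h2 : (Real.exp (x / t))⁻¹ ≤ m.factorial / x ^ m * t ^ m := by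
    refine (inv_anti₀ (by positivity) h1).trans (le_of_eq ?_)
    rw [div_pow]; field_simp
  calc Real.exp (-t) * (Real.exp (x / t))⁻¹ * t ^ (ν - 1)
      ≤ Real.exp (-t) * (m.factorial / x ^ m * t ^ m) * t ^ (ν - 1) := by gcongr
    _ = _ := by ring

theorem besselG_neg (ν : ℝ) {x : ℝ} (hx : 0 < x) : besselG (-ν) x = x ^ (-ν) * besselG ν x := by
  have h := (hasInt_inv _ _).1 ((hasInt_mul_left hx _ _).1 (hasInt_besselG (-ν) hx))
  refine h.unique (((hasInt_besselG ν hx).const_mul (x ^ (-ν))).congr measurableSet_Ioi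
    (fun t ht => ?_) rfl)
  simp only [mem_Ioi] at ht
  have e1 : x / (x * t⁻¹) = t := by field_simp
  have e2 : x * t⁻¹ = x / t := by ring
  have e3 : (x * t⁻¹) ^ (-ν - 1) = x ^ (-ν) * x⁻¹ * (t ^ (ν - 1) * t ^ 2) := by
    rw [Real.mul_rpow hx.le (by positivity), Real.inv_rpow ht.le, ← Real.rpow_neg ht.le,
      sub_eq_add_neg (-ν), Real.rpow_add hx, Real.rpow_neg_one,
      show -(-ν + -1) = (ν - 1) + (2 : ℕ) by push_cast; ring, Real.rpow_add ht, Real.rpow_natCast]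
  rw [e1, e3, e2, show -(x / t) - t = -t - x / t by ring]
  field_simp

theorem hasDerivAt_besselG (ν : ℝ) {x : ℝ} (hx : 0 < x) :
    HasDerivAt (besselG ν) (-besselG (ν - 1) x) x := by
  have key := hasDerivAt_integral_of_dominated_loc_of_deriv_le
    (μ := volume.restrict (Ioi (0 : ℝ))) (x₀ := x) (s := Ioi (x / 2))
    (F := fun x t => Real.exp (-t - x / t) * t ^ (ν - 1))
    (F' := fun x t => -(Real.exp (-t - x / t) * t ^ (ν - 1 - 1)))
    (bound := fun t => Real.exp (-t - (x / 2) / t) * t ^ (ν - 1 - 1))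
    (Ioi_mem_nhds (by linarith)) (Eventually.of_forall fun _ => by fun_prop)
    (hasInt_besselG ν hx).1 (by fun_prop) ?_ (hasInt_besselG (ν - 1) (half_pos hx)).1 ?_
  · have := key.2
    rwa [integral_neg] at this
  · refine (ae_restrict_iff' measurableSet_Ioi).2 (Eventually.of_forall fun t ht y hy => ?_)
    simp only [mem_Ioi] at ht hy
    rw [norm_neg, Real.norm_of_nonneg (by positivity)]
    gcongr
  · refine (ae_restrict_iff' measurableSet_Ioi).2 (Eventually.of_forall fun t ht y hy => ?_)
    simp only [mem_Ioi] at ht hy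
    have h := ((((hasDerivAt_id y).div_const t).const_sub (-t)).exp).mul_const (t ^ (ν - 1))
    refine h.congr_deriv ?_
    rw [Real.rpow_sub_one ht.ne' (ν - 1)]
    simp only [id]
    field_simp

theorem tendsto_besselG {ν : ℝ} (hν : 0 < ν) :
    Tendsto (besselG ν) (𝓝[>] 0) (𝓝 (Real.Gamma ν)) := by
  rw [Real.Gamma_eq_integral hν]
  refine tendsto_integral_filter_of_dominated_convergence
    (fun t => Real.exp (-t) * t ^ (ν - 1)) (Eventually.of_forall fun _ => by fun_prop) ?_
    (Real.GammaIntegral_convergent hν) ?_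
  · filter_upwards [self_mem_nhdsWithin] with x hx
    refine (ae_restrict_iff' measurableSet_Ioi).2 (Eventually.of_forall fun t ht => ?_)
    simp only [mem_Ioi] at ht hx
    rw [Real.norm_of_nonneg (by positivity)]
    gcongr
    have : 0 < x / t := by positivity
    linarith
  · refine (ae_restrict_iff' measurableSet_Ioi).2 (Eventually.of_forall fun t ht => ?_)
    have : ContinuousAt (fun x : ℝ => Real.exp (-t - x / t) * t ^ (ν - 1)) 0 := by fun_prop
    have h := this.tendsto
    simp only [zero_div, sub_zero] at h
    exact h.mono_left nhdsWithin_le_nhds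

/-- The function is elementary for `ν = 1/2`: by `besselG_neg` and `hasDerivAt_besselG` it solves
a linear differential equation of the first order. -/
theorem besselG_half {x : ℝ} (hx : 0 < x) :
    besselG (1 / 2) x = Real.sqrt Real.pi * Real.exp (-2 * Real.sqrt x) := by
  have hd : ∀ y ∈ Ioi (0 : ℝ), HasDerivAt
      (fun y => besselG (1 / 2) y * Real.exp (2 * Real.sqrt y)) 0 y := by
    intro y hy
    simp only [mem_Ioi] at hy
    have h := (hasDerivAt_besselG (1 / 2) hy).mul
      ((((hasDerivAt_id y).sqrt hy.ne').const_mul 2).exp)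
    refine h.congr_deriv ?_
    rw [show (1 / 2 - 1 : ℝ) = -(1 / 2) by norm_num, besselG_neg _ hy, Real.rpow_neg hy.le,
      ← Real.sqrt_eq_rpow]
    simp only [id]
    field_simp
    ring
  have hconst : ∀ y ∈ Ioi (0 : ℝ), besselG (1 / 2) y * Real.exp (2 * Real.sqrt y)
      = besselG (1 / 2) x * Real.exp (2 * Real.sqrt x) := by
    intro y hy
    refine isOpen_Ioi.is_const_of_deriv_eq_zero isPreconnected_Ioi
      (fun y hy => (hd y hy).differentiableAt.differentiableWithinAt)
      (fun y hy => (hd y hy).deriv) hy hx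
  have hl : Tendsto (fun y => besselG (1 / 2) y * Real.exp (2 * Real.sqrt y)) (𝓝[>] 0)
      (𝓝 (Real.Gamma (1 / 2) * Real.exp (2 * Real.sqrt 0))) := by
    refine (tendsto_besselG (by norm_num)).mul ?_
    have : ContinuousAt (fun y : ℝ => Real.exp (2 * Real.sqrt y)) 0 := by fun_prop
    exact this.tendsto.mono_left nhdsWithin_le_nhds
  have hl2 : Tendsto (fun y => besselG (1 / 2) y * Real.exp (2 * Real.sqrt y)) (𝓝[>] 0)
      (𝓝 (besselG (1 / 2) x * Real.exp (2 * Real.sqrt x))) := by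
    refine tendsto_const_nhds.congr' ?_
    filter_upwards [self_mem_nhdsWithin] with y hy
    exact (hconst y hy).symm
  have h := tendsto_nhds_unique hl2 hl
  rw [Real.Gamma_one_half_eq, Real.sqrt_zero, mul_zero, Real.exp_zero, mul_one] at h
  rw [← h, mul_assoc, ← Real.exp_add]
  simp

theorem HasInt.univ_even {F : ℝ → ℝ} {c : ℝ} (h : HasInt univ F c) :
    HasInt (Ioi 0) (fun u => F u + F (-u)) c := by
  have h1 : Integrable F := integrableOn_univ.1 h.1
  have h2 := h.2
  rw [setIntegral_univ] at h2
  refine (⟨h1.integrableOn.add h1.comp_neg.integrableOn, ?_⟩ : HasInt _ _ _)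
  rw [integral_add' h1.integrableOn h1.comp_neg.integrableOn, integral_comp_neg_Ioi, neg_zero,
    add_comm, intervalIntegral.integral_Iic_add_Ioi h1.integrableOn h1.integrableOn, h2]

theorem hasInt_besselK_univ (ν : ℝ) {z : ℝ} (hz : 0 < z) :
    HasInt univ (fun u => Real.exp (-z * Real.cosh u) * Real.exp (ν * u)) (2 * besselK ν z) ∧
      besselG ν (z ^ 2 / 4) = 2 * (z / 2) ^ ν * besselK ν z := by
  have hz2 : 0 < z / 2 := half_pos hz
  have h := (hasInt_exp hz2 _ _).1 (hasInt_besselG ν (x := z ^ 2 / 4) (by positivity))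
  have h' : HasInt univ (fun u => Real.exp (-z * Real.cosh u) * Real.exp (ν * u))
      (((z / 2) ^ ν)⁻¹ * besselG ν (z ^ 2 / 4)) := by
    refine (h.const_mul ((z / 2) ^ ν)⁻¹).congr MeasurableSet.univ (fun u _ => ?_) rfl
    have e0 : (0 : ℝ) < Real.exp u := Real.exp_pos u
    have e1 : -(z / 2 * Real.exp u) - z ^ 2 / 4 / (z / 2 * Real.exp u) = -z * Real.cosh u := by
      rw [Real.cosh_eq, Real.exp_neg]; field_simp; ring
    have e2 : (z / 2 * Real.exp u) ^ (ν - 1)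
        = (z / 2) ^ ν / (z / 2) * (Real.exp (ν * u) / Real.exp u) := by
      rw [Real.mul_rpow hz2.le e0.le, Real.rpow_sub_one hz2.ne', Real.rpow_sub_one e0.ne',
        ← Real.exp_mul, mul_comm u ν]
    rw [e1, e2]
    field_simp
  have hK : 2 * besselK ν z = ((z / 2) ^ ν)⁻¹ * besselG ν (z ^ 2 / 4) := by
    rw [← h'.univ_even.2, besselK, ← integral_const_mul]
    refine setIntegral_congr_fun measurableSet_Ioi fun u _ => ?_
    simp only [Real.cosh_neg, Real.cosh_eq (ν * u), mul_neg]
    ring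
  refine ⟨hK ▸ h', ?_⟩
  rw [show 2 * (z / 2) ^ ν * besselK ν z = (z / 2) ^ ν * (2 * besselK ν z) by ring, hK]
  field_simp

theorem besselK_pos (ν : ℝ) {z : ℝ} (hz : 0 < z) : 0 < besselK ν z := by
  have h := (hasInt_besselK_univ ν hz).1
  have h1 : 0 < ∫ u in univ, Real.exp (-z * Real.cosh u) * Real.exp (ν * u) := by
    rw [setIntegral_univ]
    refine integral_pos_of_integrable_nonneg_nonzero (x := 0) (by fun_prop)
      (integrableOn_univ.1 h.1) (fun u => by positivity) (by positivity)
  rw [h.2] at h1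
  linarith

/-! ### The Laplace representation of `K_ν`; `K_ν` as a Stieltjes transform of itself -/

/-- The Laplace integral `∫_0^∞ exp(-2zy) (y(1+y))^(-a) dy`, `z > 0`, `a < 1`, which represents
`K_ν(z)` for `a = 1/2 - ν`. -/
def laplaceK (a z : ℝ) : ℝ :=
  ∫ y in Ioi (0 : ℝ), Real.exp (-(2 * z * y)) * (y * (1 + y)) ^ (-a)

/-- The Laplace integral representation of `K_ν`. It arises on writing `exp(-z(1+2y))` as an
integral through `besselG_half` and integrating over `y` first. -/
theorem hasInt_laplaceK {ν z : ℝ} (hν : -(1 / 2) < ν) (hz : 0 < z) :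
    HasInt (Ioi 0) (fun y => Real.exp (-(2 * z * y)) * (y * (1 + y)) ^ (-(1 / 2 - ν)))
      (laplaceK (1 / 2 - ν) z) ∧
    laplaceK (1 / 2 - ν) z =
      Real.Gamma (ν + 1 / 2) / Real.sqrt Real.pi * (2 * z) ^ (-ν) * Real.exp z * besselK ν z := by
  have key : HasInt (Ioi 0)
      (fun y => (2 * Real.sqrt Real.pi * Real.exp (-z) / z) *
        (Real.exp (-(2 * z * y)) * (y * (1 + y)) ^ (-(1 / 2 - ν))))
      (Real.Gamma (ν + 1 / 2) / (z ^ 2) ^ (ν + 1 / 2) * besselG ν (z ^ 2 / 4)) := by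
    refine HasInt.tonelli (s := Ioi 0) measurableSet_Ioi measurableSet_Ioi
      (f := fun r y => (1 + 2 * y) * (y * (1 + y)) ^ (-(1 / 2 - ν)) *
        (Real.exp (-r - (z * (1 + 2 * y)) ^ 2 / 4 / r) * r ^ (-(1 / 2) - 1 : ℝ)))
      (g := fun r => Real.Gamma (ν + 1 / 2) / (z ^ 2) ^ (ν + 1 / 2) *
        (Real.exp (-r - z ^ 2 / 4 / r) * r ^ (ν - 1))) ?_ ?_ ?_ ?_
        ((hasInt_besselG ν (by positivity)).const_mul _)
    · unfold Function.uncurry; fun_prop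
    · intro r hr y hy
      simp only [mem_Ioi] at hr hy
      positivity
    · intro r hr
      simp only [mem_Ioi] at hr
      have h := ((hasInt_mul_one_add _ _).1 (hasInt_Gamma (p := ν + 1 / 2) (b := z ^ 2 / r)
        (by linarith) (by positivity))).const_mul
          (Real.exp (-r - z ^ 2 / 4 / r) * r ^ (-(1 / 2) - 1 : ℝ))
      refine h.congr measurableSet_Ioi (fun y hy => ?_) ?_
      · have e : -r - (z * (1 + 2 * y)) ^ 2 / 4 / r
            = (-r - z ^ 2 / 4 / r) + -(z ^ 2 / r * (y * (1 + y))) := by ring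
        rw [e, Real.exp_add, show ν + 1 / 2 - 1 = -(1 / 2 - ν) by ring]
        ring
      · have e : r ^ (ν - 1) = r ^ (-(1 / 2) - 1 : ℝ) * r ^ (ν + 1 / 2) := by
          rw [← Real.rpow_add hr]; congr 1; ring
        rw [Real.div_rpow (by positivity) hr.le, e]
        field_simp
    · intro y hy
      simp only [mem_Ioi] at hy
      have hc : 0 < (z * (1 + 2 * y)) ^ 2 / 4 := by positivity
      refine ((hasInt_besselG (-(1 / 2)) hc).const_mul
        ((1 + 2 * y) * (y * (1 + y)) ^ (-(1 / 2 - ν)))).congr measurableSet_Ioi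
        (fun r _ => rfl) ?_
      have es : Real.sqrt ((z * (1 + 2 * y)) ^ 2 / 4) = z * (1 + 2 * y) / 2 := by
        rw [show (z * (1 + 2 * y)) ^ 2 / 4 = (z * (1 + 2 * y) / 2) ^ 2 by ring,
          Real.sqrt_sq (by positivity)]
      rw [besselG_neg _ hc, besselG_half hc, Real.rpow_neg hc.le, ← Real.sqrt_eq_rpow, es,
        show -2 * (z * (1 + 2 * y) / 2) = -z + -(2 * z * y) by ring, Real.exp_add]
      field_simp
  have h2 := key.const_mul (2 * Real.sqrt Real.pi * Real.exp (-z) / z)⁻¹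
  have h3 := h2.congr (G := fun y => Real.exp (-(2 * z * y)) * (y * (1 + y)) ^ (-(1 / 2 - ν)))
    measurableSet_Ioi (fun y _ => inv_mul_cancel_left₀ (by positivity) _) rfl
  refine ⟨⟨h3.1, rfl⟩, ?_⟩
  rw [laplaceK, h3.2, (hasInt_besselK_univ ν hz).2, Real.exp_neg]
  have e1 : (z ^ 2) ^ (ν + 1 / 2) = z ^ ν * z ^ ν * z := by
    rw [← Real.rpow_natCast, ← Real.rpow_mul hz.le, ← Real.rpow_add hz, ← Real.rpow_add_one hz.ne']
    congr 1; push_cast; ring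
  have e2 : (z / 2) ^ ν = z ^ ν / 2 ^ ν := Real.div_rpow hz.le (by norm_num) ν
  have e3 : (2 * z) ^ (-ν) = (2 ^ ν * z ^ ν)⁻¹ := by
    rw [Real.rpow_neg (by positivity), Real.mul_rpow (by norm_num) hz.le]
  rw [e1, e2, e3]
  field_simp

theorem rpow_neg_mul_laplaceK {ν t : ℝ} (hν : -(1 / 2) < ν) (ht : 0 < t) :
    t ^ (-(1 / 2 - ν)) * (Real.exp (-(2 * t)) * laplaceK (1 / 2 - ν) t) =
      Real.Gamma (ν + 1 / 2) / (Real.sqrt Real.pi * 2 ^ ν) *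
        (t ^ (-(1 / 2) : ℝ) * Real.exp (-t) * besselK ν t) := by
  rw [(hasInt_laplaceK hν ht).2, Real.mul_rpow (by norm_num) ht.le,
    show -(2 * t) = -t + -t by ring, Real.exp_add, Real.exp_neg t,
    show -(1 / 2 - ν) = -(1 / 2) + ν by ring, Real.rpow_add ht, Real.rpow_neg ht.le ν,
    Real.rpow_neg (by norm_num : (0 : ℝ) ≤ 2)]
  field_simp

/-- `(1+y)^(-a)` is a Stieltjes transform for `0 < a < 1`. -/
theorem hasInt_stieltjes_rpow {a b : ℝ} (ha : 0 < a) (ha1 : a < 1) (hb : 0 < b) :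
    HasInt (Ioi 0) (fun η => η ^ (-a) / (η + b))
      (b ^ (-a) * (Real.pi / Real.sin (Real.pi * a))) := by
  have h := (hasInt_beta (p := 1 - a) (q := a) (by linarith) ha)
  rw [hasInt_mul_left (b := b⁻¹) (by positivity)] at h
  refine (h.const_mul (b ^ (-a))).congr measurableSet_Ioi (fun η hη => ?_) ?_
  · simp only [mem_Ioi] at hη
    rw [show 1 - a - 1 = -a by ring, show 1 - a + a = 1 by ring, Real.rpow_one,
      Real.mul_rpow (by positivity) hη.le, Real.inv_rpow hb.le]
    field_simp
    ring
  · rw [show 1 - a + a = 1 by ring, Real.Gamma_one, div_one, mul_comm (Real.Gamma (1 - a)),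
      Real.Gamma_mul_Gamma_one_sub]

/-- `K_ν` reproduces itself under a Stieltjes transform. In the Laplace representation
`laplaceK` of `K_ν`, write `(1+y)^(-a)` as a Stieltjes transform with variable `η` and substitute
`y = (1+η)t/z`: the integral over `η` is the same Laplace integral at `t`. -/
theorem hasInt_stieltjes_besselK {ν z : ℝ} (hν : |ν| < 1 / 2) (hz : 0 < z) :
    HasInt (Ioi 0) (fun t => t ^ (-(1 / 2) : ℝ) * Real.exp (-t) * besselK ν t / (1 + t / z))
      (Real.pi / Real.cos (Real.pi * ν) * (Real.sqrt z * Real.exp z * besselK ν z)) := by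
  obtain ⟨hν1, hν2⟩ := abs_lt.1 hν
  set a := 1 / 2 - ν with ha
  have ha0 : 0 < a := by linarith
  have ha1 : a < 1 := by linarith
  have hsin : Real.sin (Real.pi * a) = Real.cos (Real.pi * ν) := by
    rw [ha, ← Real.sin_pi_div_two_sub]; congr 1; ring
  have hsp : 0 < Real.sin (Real.pi * a) :=
    Real.sin_pos_of_pos_of_lt_pi (by positivity) (by nlinarith [Real.pi_pos])
  -- the double integral in the variables `y`, `η`
  set g : ℝ → ℝ := fun η => ∫ y in Ioi (0 : ℝ),
    Real.exp (-(2 * z * y)) * y ^ (-a) * (η ^ (-a) / (η + (1 + y))) with hg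
  have hlap := (hasInt_laplaceK hν1 hz).1
  rw [← ha] at hlap
  have hyint : HasInt (Ioi 0)
      (fun y => Real.exp (-(2 * z * y)) * y ^ (-a)) (Real.Gamma (1 - a) / (2 * z) ^ (1 - a)) := by
    refine (hasInt_Gamma (p := 1 - a) (b := 2 * z) (by linarith) (by positivity)).congr
      measurableSet_Ioi (fun y _ => ?_) rfl
    rw [show 1 - a - 1 = -a by ring]; ring
  have hgi : ∀ η ∈ Ioi (0 : ℝ), HasInt (Ioi 0) (fun y =>
      Real.exp (-(2 * z * y)) * y ^ (-a) * (η ^ (-a) / (η + (1 + y)))) (g η) := by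
    intro η hη
    simp only [mem_Ioi] at hη
    refine ⟨Integrable.mono' (hyint.const_mul (η ^ (-a))).1 (by fun_prop) ?_, rfl⟩
    refine (ae_restrict_iff' measurableSet_Ioi).2 (Eventually.of_forall fun y hy => ?_)
    simp only [mem_Ioi] at hy
    rw [Real.norm_of_nonneg (by positivity), mul_comm]
    gcongr
    exact div_le_self (by positivity) (by linarith)
  have h1 : HasInt (Ioi 0) g (Real.pi / Real.sin (Real.pi * a) * laplaceK a z) := by
    refine HasInt.tonelli (s := Ioi 0) measurableSet_Ioi measurableSet_Ioi
      (f := fun y η => Real.exp (-(2 * z * y)) * y ^ (-a) * (η ^ (-a) / (η + (1 + y))))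
      (g := fun y => Real.pi / Real.sin (Real.pi * a) *
        (Real.exp (-(2 * z * y)) * (y * (1 + y)) ^ (-a))) ?_ ?_ ?_ hgi (hlap.const_mul _)
    · unfold Function.uncurry; fun_prop
    · intro y hy η hη
      simp only [mem_Ioi] at hy hη
      positivity
    · intro y hy
      simp only [mem_Ioi] at hy
      refine ((hasInt_stieltjes_rpow ha0 ha1 (b := 1 + y) (by linarith)).const_mul
        (Real.exp (-(2 * z * y)) * y ^ (-a))).congr measurableSet_Ioi (fun η _ => rfl) ?_
      rw [Real.mul_rpow hy.le (by linarith)]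
      ring
  have h2 : HasInt (Ioi 0)
      (fun t => t ^ (-a) / (1 + t / z) * (Real.exp (-(2 * t)) * laplaceK a t))
      (z ^ (1 - a) * (Real.pi / Real.sin (Real.pi * a) * laplaceK a z)) := by
    refine HasInt.tonelli (s := Ioi 0) measurableSet_Ioi measurableSet_Ioi
      (f := fun η t => t ^ (-a) / (1 + t / z) *
        (Real.exp (-(2 * t)) * (Real.exp (-(2 * t * η)) * (η * (1 + η)) ^ (-a))))
      (g := fun η => z ^ (1 - a) * g η) ?_ ?_ ?_ ?_ (h1.const_mul _)
    · unfold Function.uncurry; fun_prop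
    · intro η hη t ht
      simp only [mem_Ioi] at ht hη
      positivity
    · intro η hη
      have h := (hasInt_mul_left (b := (1 + η) / z) (by simp only [mem_Ioi] at hη; positivity)
        _ _).1 (hgi η hη)
      refine (h.const_mul (z ^ (1 - a))).congr measurableSet_Ioi (fun t ht => ?_) rfl
      simp only [mem_Ioi] at ht hη
      have e1 : -(2 * z * ((1 + η) / z * t)) = -(2 * t) + -(2 * t * η) := by
        field_simp; ring
      have e2 : η + (1 + (1 + η) / z * t) = (1 + η) * (1 + t / z) := by ring
      rw [e1, e2, Real.exp_add, show (1 + η) / z * t = (1 + η) * t / z by ring,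
        Real.div_rpow (by positivity) hz.le, Real.mul_rpow (by positivity) ht.le,
        Real.mul_rpow hη.le (by positivity), sub_eq_add_neg, Real.rpow_add hz, Real.rpow_one]
      field_simp
    · intro t ht
      exact (((hasInt_laplaceK hν1 ht).1.const_mul (Real.exp (-(2 * t)))).const_mul
        (t ^ (-a) / (1 + t / z)))
  have hGp := Real.Gamma_pos_of_pos (s := ν + 1 / 2) (by linarith)
  refine (h2.const_mul (Real.Gamma (ν + 1 / 2) / (Real.sqrt Real.pi * 2 ^ ν))⁻¹).congr
    measurableSet_Ioi (fun t ht => ?_) ?_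
  · have h := rpow_neg_mul_laplaceK hν1 ht
    rw [← ha] at h
    rw [div_mul_eq_mul_div, h]
    generalize Real.Gamma (ν + 1 / 2) = γ at hGp
    field_simp
  · rw [ha, (hasInt_laplaceK hν1 hz).2, ← ha, hsin,
      show 1 - a = 1 / 2 + ν by rw [ha]; ring, Real.rpow_add hz, ← Real.sqrt_eq_rpow,
      Real.mul_rpow (by norm_num) hz.le, Real.rpow_neg hz.le, Real.rpow_neg (by norm_num)]
    generalize Real.Gamma (ν + 1 / 2) = γ at hGp
    field_simp

/-- The moments of `t^(-1/2) e^(-t) K_ν(t)`, from the Laplace representation and a beta integral.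
They generate the coefficients `a_n(ν)`. -/
theorem hasInt_moment_gamma {ν : ℝ} (hν : |ν| < 1 / 2) (n : ℕ) :
    HasInt (Ioi 0) (fun t => t ^ n * (t ^ (-(1 / 2) : ℝ) * Real.exp (-t) * besselK ν t))
      (Real.sqrt Real.pi * 2 ^ ν * (1 / 2) ^ (n + (1 / 2 + ν)) *
        (Real.Gamma (n + (1 / 2 + ν)) * Real.Gamma (n + (1 / 2 - ν)) / n.factorial)) := by
  obtain ⟨hν1, hν2⟩ := abs_lt.1 hν
  have hGp := Real.Gamma_pos_of_pos (s := ν + 1 / 2) (by linarith)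
  have hb := hasInt_beta (p := 1 / 2 + ν) (q := n + (1 / 2 - ν)) (by linarith) (by linarith)
  rw [show 1 / 2 + ν + (n + (1 / 2 - ν)) = (n : ℝ) + 1 by ring, Real.Gamma_nat_eq_factorial] at hb
  have h2 : HasInt (Ioi 0)
      (fun t => t ^ n * (t ^ (-(1 / 2 - ν)) * (Real.exp (-(2 * t)) * laplaceK (1 / 2 - ν) t)))
      ((1 / 2) ^ (n + (1 / 2 + ν)) * Real.Gamma (n + (1 / 2 + ν)) *
        (Real.Gamma (1 / 2 + ν) * Real.Gamma (n + (1 / 2 - ν)) / n.factorial)) := by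
    refine HasInt.tonelli (s := Ioi 0) measurableSet_Ioi measurableSet_Ioi
      (f := fun η t => t ^ n * (t ^ (-(1 / 2 - ν)) *
        (Real.exp (-(2 * t)) * (Real.exp (-(2 * t * η)) * (η * (1 + η)) ^ (-(1 / 2 - ν))))))
      ?_ ?_ ?_ ?_ (hb.const_mul _)
    · unfold Function.uncurry; fun_prop
    · intro η hη t ht
      simp only [mem_Ioi] at ht hη
      positivity
    · intro η hη
      simp only [mem_Ioi] at hη
      refine ((hasInt_Gamma (p := n + (1 / 2 + ν)) (b := 2 * (1 + η)) (by linarith)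
        (by positivity)).const_mul ((η * (1 + η)) ^ (-(1 / 2 - ν)))).congr measurableSet_Ioi
          (fun t ht => ?_) ?_
      · simp only [mem_Ioi] at ht
        rw [show -(2 * (1 + η) * t) = -(2 * t) + -(2 * t * η) by ring, Real.exp_add,
          show n + (1 / 2 + ν) - 1 = n + (-(1 / 2 - ν)) by ring, Real.rpow_add ht,
          Real.rpow_natCast]
        ring
      · have h1η : 0 < 1 + η := by linarith
        rw [Real.mul_rpow hη.le h1η.le, Real.mul_rpow (by norm_num) h1η.le,
          show (n : ℝ) + 1 = (n + (1 / 2 + ν)) + (1 / 2 - ν) by ring,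
          Real.rpow_neg h1η.le, Real.div_rpow (by norm_num) (by norm_num), Real.one_rpow,
          show 1 / 2 + ν - 1 = -(1 / 2 - ν) by ring]
        have := Real.rpow_pos_of_pos h1η (1 / 2 - ν)
        generalize (n : ℝ) + (1 / 2 + ν) = p
        generalize 1 / 2 - ν = q at this
        rw [Real.rpow_add h1η]
        field_simp
    · intro t ht
      exact ((((hasInt_laplaceK hν1 ht).1.const_mul (Real.exp (-(2 * t)))).const_mul
        (t ^ (-(1 / 2 - ν))))).const_mul (t ^ n)
  refine (h2.const_mul (Real.Gamma (ν + 1 / 2) / (Real.sqrt Real.pi * 2 ^ ν))⁻¹).congr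
    measurableSet_Ioi (fun t ht => ?_) ?_
  · rw [rpow_neg_mul_laplaceK hν1 ht]
    generalize Real.Gamma (ν + 1 / 2) = γ at hGp
    field_simp
  · rw [add_comm (1 / 2) ν]
    generalize Real.Gamma (ν + 1 / 2) = γ at hGp
    generalize Real.Gamma (n + (ν + 1 / 2)) = γ'
    generalize Real.Gamma (n + (1 / 2 - ν)) = γ''
    field_simp

/-! ### Continuation in `ν`: the remainders `R_N^{(K)}` as integral transforms -/

/-- A two-sided Laplace transform of a nonnegative weight is analytic where it converges; this is
the analyticity of moment-generating functions. -/
theorem analyticOnNhd_laplace {W : ℝ → ℝ} (hW : Measurable W) (hW0 : ∀ u, 0 ≤ W u) {r : ℝ}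
    (hi : ∀ ν ∈ Ioo (-r) r, Integrable (fun u => W u * Real.exp (ν * u))) :
    AnalyticOnNhd ℝ (fun ν => ∫ u, W u * Real.exp (ν * u)) (Ioo (-r) r) := by
  set μ : Measure ℝ := volume.withDensity fun u => ENNReal.ofReal (W u) with hμ
  have hm : Measurable fun u => ENNReal.ofReal (W u) := hW.ennreal_ofReal
  have e1 : ∀ u ν : ℝ, (ENNReal.ofReal (W u)).toReal • Real.exp (ν * id u)
      = W u * Real.exp (ν * u) := fun u ν => by
    rw [ENNReal.toReal_ofReal (hW0 u), smul_eq_mul, id]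
  have e2 : (fun ν => ∫ u, W u * Real.exp (ν * u)) = ProbabilityTheory.mgf id μ := by
    ext ν
    rw [ProbabilityTheory.mgf, hμ, integral_withDensity_eq_integral_toReal_smul hm
      (Eventually.of_forall fun _ => ENNReal.ofReal_lt_top)]
    simp only [e1]
  rw [e2]
  refine ProbabilityTheory.analyticOnNhd_mgf.mono ?_
  refine interior_maximal (fun ν hν => ?_) isOpen_Ioo
  change Integrable _ _
  rw [hμ, integrable_withDensity_iff_integrable_smul' hm
    (Eventually.of_forall fun _ => ENNReal.ofReal_lt_top)]
  simp only [e1]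
  exact hi ν hν

/-- The weight `t^(-1/2) e^(-t) K_ν(t)` of the integral representations of the remainders. -/
def weightK (ν t : ℝ) : ℝ := t ^ (-(1 / 2) : ℝ) * Real.exp (-t) * besselK ν t

/-- The integral `∫_0^∞ t^(n-1/2) e^(-t) K_ν(t) κ(t) dt`. -/
def kernelIntegral (n : ℕ) (κ : ℝ → ℝ) (ν : ℝ) : ℝ :=
  ∫ t in Ioi (0 : ℝ), t ^ n * weightK ν t * κ t

theorem weightK_pos (ν : ℝ) {t : ℝ} (ht : 0 < t) : 0 < weightK ν t := by
  have := besselK_pos ν ht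
  unfold weightK
  positivity

/-- A beta integral in the variable `e^u`. -/
theorem hasInt_exp_div_one_add_cosh {ν c : ℝ} (hν : ν ∈ Ioo (-c) c) :
    HasInt univ (fun u => Real.exp (ν * u) / (1 + Real.cosh u) ^ c)
      (2 ^ c * (Real.Gamma (ν + c) * Real.Gamma (c - ν) / Real.Gamma (ν + c + (c - ν)))) := by
  have h := (hasInt_exp one_pos _ _).1
    (hasInt_beta (p := ν + c) (q := c - ν) (by linarith [hν.1]) (by linarith [hν.2]))
  refine (h.const_mul (2 ^ c)).congr MeasurableSet.univ (fun u _ => ?_) rfl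
  have hv : 0 < Real.exp u := Real.exp_pos u
  have e1 : 1 + Real.cosh u = (1 + Real.exp u) ^ 2 / (2 * Real.exp u) := by
    rw [Real.cosh_eq, Real.exp_neg]; field_simp; ring
  have e2 : (1 + Real.exp u) ^ (ν + c + (c - ν)) = ((1 + Real.exp u) ^ 2) ^ c := by
    rw [← Real.rpow_natCast, ← Real.rpow_mul (by positivity)]; congr 1; push_cast; ring
  rw [one_mul, e1, e2, Real.div_rpow (by positivity) (by positivity),
    Real.mul_rpow (by norm_num) hv.le, Real.rpow_sub_one hv.ne', Real.rpow_add hv,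
    mul_comm ν u, Real.exp_mul u ν]
  field_simp

/-- Inserting `2 K_ν(t) = ∫ exp(-t cosh u + νu) du` and integrating over `t` first shows that a
`kernelIntegral` converges for `|ν| < n + 1/2` and is analytic in `ν` there. -/
theorem kernelIntegral_spec {κ : ℝ → ℝ} (hκ : Measurable κ) (hκ0 : ∀ t, 0 < t → 0 ≤ κ t)
    (hκ1 : ∀ t, 0 < t → κ t ≤ 1) (n : ℕ) :
    (∀ ν ∈ Ioo (-((n : ℝ) + 1 / 2)) (n + 1 / 2),
      HasInt (Ioi 0) (fun t => t ^ n * weightK ν t * κ t) (kernelIntegral n κ ν)) ∧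
    AnalyticOnNhd ℝ (kernelIntegral n κ) (Ioo (-((n : ℝ) + 1 / 2)) (n + 1 / 2)) := by
  set c : ℝ := n + 1 / 2 with hc
  have hc0 : 0 < c := by positivity
  set W : ℝ → ℝ := fun u => ∫ t in Ioi (0 : ℝ),
    t ^ (c - 1) * Real.exp (-((1 + Real.cosh u) * t)) * |κ t| with hW
  have hm2 : Measurable (Function.uncurry fun u t : ℝ =>
      t ^ (c - 1) * Real.exp (-((1 + Real.cosh u) * t)) * |κ t|) := by
    unfold Function.uncurry
    exact Measurable.mul (by fun_prop) (hκ.comp measurable_snd).abs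
  have hWm : Measurable W := (hm2.stronglyMeasurable.integral_prod_right).measurable
  have hG : ∀ u, HasInt (Ioi 0) (fun t => t ^ (c - 1) * Real.exp (-((1 + Real.cosh u) * t)))
      (Real.Gamma c / (1 + Real.cosh u) ^ c) := fun u =>
    hasInt_Gamma hc0 (by linarith [Real.one_le_cosh u])
  have hle : ∀ u, ∀ t ∈ Ioi (0 : ℝ), t ^ (c - 1) * Real.exp (-((1 + Real.cosh u) * t)) * |κ t| ≤
      t ^ (c - 1) * Real.exp (-((1 + Real.cosh u) * t)) := fun u t ht => by
    simp only [mem_Ioi] at ht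
    rw [abs_of_nonneg (hκ0 t ht)]
    exact mul_le_of_le_one_right (by positivity) (hκ1 t ht)
  have h0 : ∀ u, ∀ t ∈ Ioi (0 : ℝ),
      0 ≤ t ^ (c - 1) * Real.exp (-((1 + Real.cosh u) * t)) * |κ t| := fun u t ht => by
    simp only [mem_Ioi] at ht
    positivity
  have hWi : ∀ u, HasInt (Ioi 0)
      (fun t => t ^ (c - 1) * Real.exp (-((1 + Real.cosh u) * t)) * |κ t|) (W u) := fun u => by
    refine ⟨Integrable.mono' (hG u).1 ?_ ?_, rfl⟩
    · exact (Measurable.mul (by fun_prop) hκ.abs).aestronglyMeasurable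
    · refine (ae_restrict_iff' measurableSet_Ioi).2 (Eventually.of_forall fun t ht => ?_)
      rw [Real.norm_of_nonneg (h0 u t ht)]
      exact hle u t ht
  have hW0 : ∀ u, 0 ≤ W u := fun u => setIntegral_nonneg measurableSet_Ioi (h0 u)
  have hWle : ∀ u, W u ≤ Real.Gamma c / (1 + Real.cosh u) ^ c := fun u => by
    rw [← (hG u).2]
    exact setIntegral_mono_on (hWi u).1 (hG u).1 measurableSet_Ioi (hle u)
  have hint : ∀ ν ∈ Ioo (-c) c, Integrable (fun u => W u * Real.exp (ν * u)) := fun ν hν => by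
    have hb := integrableOn_univ.1 ((hasInt_exp_div_one_add_cosh hν).const_mul (Real.Gamma c)).1
    refine Integrable.mono' hb (by fun_prop) (Eventually.of_forall fun u => ?_)
    rw [Real.norm_of_nonneg (mul_nonneg (hW0 u) (Real.exp_pos _).le)]
    calc W u * Real.exp (ν * u) ≤ Real.Gamma c / (1 + Real.cosh u) ^ c * Real.exp (ν * u) := by
          gcongr; exact hWle u
      _ = _ := by ring
  have hfin : ∀ ν ∈ Ioo (-c) c, HasInt (Ioi 0) (fun t => t ^ n * weightK ν t * κ t)
      (1 / 2 * ∫ u, W u * Real.exp (ν * u)) := fun ν hν => by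
    have hu : HasInt univ (fun u => W u * Real.exp (ν * u)) (∫ u, W u * Real.exp (ν * u)) :=
      ⟨(hint ν hν).integrableOn, by rw [setIntegral_univ]⟩
    have hT := HasInt.tonelli (s := univ) (t := Ioi 0) MeasurableSet.univ measurableSet_Ioi
      (f := fun u t => t ^ (c - 1) * Real.exp (-((1 + Real.cosh u) * t)) * |κ t| *
        Real.exp (ν * u))
      (h := fun t => (t ^ (c - 1) * Real.exp (-t) * |κ t|) * (2 * besselK ν t))
      ?_ ?_ ?_ ?_ hu
    · refine (hT.const_mul (1 / 2)).congr measurableSet_Ioi (fun t ht => ?_) rfl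
      simp only [mem_Ioi] at ht
      rw [abs_of_nonneg (hκ0 t ht), show c - 1 = n + -(1 / 2) by rw [hc]; ring,
        Real.rpow_add ht, Real.rpow_natCast, weightK]
      ring
    · exact hm2.mul (by fun_prop)
    · intro u _ t ht
      exact mul_nonneg (h0 u t ht) (Real.exp_pos _).le
    · intro u _
      refine ((hWi u).const_mul (Real.exp (ν * u))).congr measurableSet_Ioi (fun t _ => ?_) ?_
      · ring
      · ring
    · intro t ht
      refine ((hasInt_besselK_univ ν ht).1.const_mul (t ^ (c - 1) * Real.exp (-t) * |κ t|)).congr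
        MeasurableSet.univ (fun u _ => ?_) rfl
      rw [show -((1 + Real.cosh u) * t) = -t + -t * Real.cosh u by ring, Real.exp_add]
      ring
  refine ⟨fun ν hν => ⟨(hfin ν hν).1, rfl⟩, ?_⟩
  exact ((analyticOnNhd_const (v := (1 / 2 : ℝ))).mul
    (analyticOnNhd_laplace hWm hW0 hint)).congr isOpen_Ioo fun ν hν => (hfin ν hν).2.symm

theorem analyticOnNhd_besselK {z : ℝ} (hz : 0 < z) :
    AnalyticOnNhd ℝ (fun ν => besselK ν z) univ := by
  intro ν _
  have h := analyticOnNhd_laplace (W := fun u => Real.exp (-z * Real.cosh u)) (by fun_prop)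
    (fun u => (Real.exp_pos _).le) (r := |ν| + 1)
    (fun ν _ => integrableOn_univ.1 (hasInt_besselK_univ ν hz).1.1) ν
    ⟨by linarith [neg_abs_le ν], by linarith [le_abs_self ν]⟩
  refine ((analyticAt_const (v := (1 / 2 : ℝ))).mul h).congr (Eventually.of_forall fun ν => ?_)
  have := (hasInt_besselK_univ ν hz).1.2
  rw [setIntegral_univ] at this
  simp only [Pi.mul_apply, this]
  ring

theorem cos_mul_Gamma_mul_Gamma {ν : ℝ} (hν : |ν| < 1 / 2) (n : ℕ) :
    Real.cos (Real.pi * ν) * (Real.Gamma (n + (1 / 2 + ν)) * Real.Gamma (n + (1 / 2 - ν)))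
      = Real.pi * ((-1) ^ n * 2 ^ n * n.factorial * coeffA n ν) := by
  obtain ⟨hν1, hν2⟩ := abs_lt.1 hν
  induction n with
  | zero =>
    have h := Real.Gamma_mul_Gamma_one_sub (1 / 2 + ν)
    rw [show 1 - (1 / 2 + ν) = 1 / 2 - ν by ring,
      show Real.pi * (1 / 2 + ν) = Real.pi * ν + Real.pi / 2 by ring,
      Real.sin_add_pi_div_two] at h
    have hc : 0 < Real.cos (Real.pi * ν) := Real.cos_pos_of_mem_Ioo
      ⟨by nlinarith [Real.pi_pos], by nlinarith [Real.pi_pos]⟩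
    simp only [Nat.cast_zero, zero_add, h, coeffA]
    simp
    field_simp
  | succ n ih =>
    rw [show ((n + 1 : ℕ) : ℝ) + (1 / 2 + ν) = (n + (1 / 2 + ν)) + 1 by push_cast; ring,
      show ((n + 1 : ℕ) : ℝ) + (1 / 2 - ν) = (n + (1 / 2 - ν)) + 1 by push_cast; ring,
      Real.Gamma_add_one (by linarith), Real.Gamma_add_one (by linarith)]
    have hA : coeffA (n + 1) ν = coeffA n ν * (4 * ν ^ 2 - (2 * n + 1) ^ 2) / (8 * (n + 1)) := by
      unfold coeffA
      rw [Finset.prod_range_succ, Nat.factorial_succ]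
      push_cast
      field_simp
      ring
    rw [hA, Nat.factorial_succ]
    push_cast
    field_simp
    ring_nf at ih ⊢
    linear_combination (n + 1 / 2 + ν) * (n + 1 / 2 - ν) * 32 * ih

/-- The common factor `cos(πν)/π · (2/π)^(1/2)` of the integral representations. -/
def reprConst (ν : ℝ) : ℝ := Real.cos (Real.pi * ν) / Real.pi * Real.sqrt (2 / Real.pi)

theorem coeffA_eq_moment_of_lt_half {ν : ℝ} (hν : |ν| < 1 / 2) (n : ℕ) :
    coeffA n ν = (-1) ^ n * reprConst ν * kernelIntegral n (fun _ => 1) ν := by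
  have hm := hasInt_moment_gamma hν n
  have h1 : kernelIntegral n (fun _ => 1) ν = Real.sqrt Real.pi * 2 ^ ν *
      (1 / 2) ^ (n + (1 / 2 + ν)) *
        (Real.Gamma (n + (1 / 2 + ν)) * Real.Gamma (n + (1 / 2 - ν)) / n.factorial) := by
    rw [← hm.2]
    simp only [kernelIntegral, weightK, mul_one]
  have h2 := cos_mul_Gamma_mul_Gamma hν n
  have e1 : ((1 : ℝ) / 2) ^ (n + (1 / 2 + ν)) = (2 ^ n * Real.sqrt 2 * 2 ^ ν)⁻¹ := by
    rw [Real.sqrt_eq_rpow, Real.div_rpow (by norm_num) (by norm_num), Real.one_rpow,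
      Real.rpow_add (by norm_num), Real.rpow_add (by norm_num), Real.rpow_natCast, one_div,
      mul_assoc]
  rw [h1, reprConst, e1, Real.sqrt_div (by norm_num)]
  have hpi := Real.pi_pos
  have h4 : ((-1 : ℝ) ^ n) * (-1) ^ n = 1 := by rw [← mul_pow]; simp
  generalize Real.Gamma (n + (1 / 2 + ν)) = γ at h2 ⊢
  generalize Real.Gamma (n + (1 / 2 - ν)) = γ' at h2 ⊢
  field_simp
  linear_combination (-(-1) ^ n) * h2 - Real.pi * coeffA n ν * 2 ^ n * n.factorial * h4

theorem stieltjesKernel_bounds {z : ℝ} (hz : 0 < z) :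
    (Measurable fun t : ℝ => (1 + t / z)⁻¹) ∧ (∀ t, 0 < t → 0 ≤ (1 + t / z)⁻¹) ∧
      ∀ t, 0 < t → (1 + t / z)⁻¹ ≤ 1 := by
  refine ⟨by fun_prop, fun t ht => by positivity, fun t ht => inv_le_one_of_one_le₀ ?_⟩
  have : 0 < t / z := by positivity
  linarith

/-- Splitting `1 = (1 + t/z)⁻¹ + (t/z) (1 + t/z)⁻¹` relates the remainders of orders `n`
and `n + 1`. -/
theorem moment_eq_add {ν z : ℝ} (n : ℕ)
    (hν : ν ∈ Ioo (-((n : ℝ) + 1 / 2)) (n + 1 / 2)) (hz : 0 < z) :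
    kernelIntegral n (fun _ => 1) ν = kernelIntegral n (fun t => (1 + t / z)⁻¹) ν
      + z⁻¹ * kernelIntegral (n + 1) (fun t => (1 + t / z)⁻¹) ν := by
  obtain ⟨h1, h2, h3⟩ := stieltjesKernel_bounds hz
  have a1 := (kernelIntegral_spec h1 h2 h3 n).1 ν hν
  have a2 := (kernelIntegral_spec h1 h2 h3 (n + 1)).1 ν
    ⟨by push_cast; linarith [hν.1], by push_cast; linarith [hν.2]⟩
  have a3 := (kernelIntegral_spec (κ := fun _ => 1) measurable_const (fun _ _ => zero_le_one)
    (fun _ _ => le_rfl) n).1 ν hν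
  refine a3.unique ((a1.add (a2.const_mul z⁻¹)).congr measurableSet_Ioi (fun t ht => ?_) rfl)
  simp only [mem_Ioi] at ht
  field_simp
  ring

theorem remainderK_eq_of_lt_half {ν z : ℝ} (hν : |ν| < 1 / 2) (hz : 0 < z) (N : ℕ) :
    remainderK N z ν = (-1) ^ N * reprConst ν / z ^ N *
      kernelIntegral N (fun t => (1 + t / z)⁻¹) ν := by
  obtain ⟨hν1, hν2⟩ := abs_lt.1 hν
  have hpi := Real.pi_pos
  induction N with
  | zero =>
    have hc : 0 < Real.cos (Real.pi * ν) := Real.cos_pos_of_mem_Ioo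
      ⟨by nlinarith [Real.pi_pos], by nlinarith [Real.pi_pos]⟩
    have h := (hasInt_stieltjes_besselK hν hz).2
    have h1 : kernelIntegral 0 (fun t => (1 + t / z)⁻¹) ν =
        Real.pi / Real.cos (Real.pi * ν) * (Real.sqrt z * Real.exp z * besselK ν z) := by
      rw [← h]
      simp only [kernelIntegral, weightK, pow_zero, one_mul, div_eq_mul_inv]
    rw [h1, remainderK, reprConst, Real.exp_neg, Real.sqrt_div hpi.le, Real.sqrt_div (by norm_num),
      Real.sqrt_mul (by norm_num)]
    simp only [Finset.range_zero, Finset.sum_empty, pow_zero]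
    field_simp
    simp
  | succ N ih =>
    have e : remainderK (N + 1) z ν = remainderK N z ν - coeffA N ν / z ^ N := by
      simp only [remainderK, Finset.sum_range_succ]; ring
    rw [e, ih, coeffA_eq_moment_of_lt_half hν, moment_eq_add N ⟨by linarith, by linarith⟩ hz]
    field_simp
    ring

/-- The remainder of the expansion of `K_ν` as a Stieltjes transform of `K_ν` itself. It holds for
`|ν| < 1/2` by `hasInt_stieltjes_besselK`, and for `|ν| < N + 1/2` by analytic continuation
in `ν`. -/
theorem remainderK_eq {ν z : ℝ} {N : ℕ} (hν : ν ∈ Ioo (-((N : ℝ) + 1 / 2)) (N + 1 / 2))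
    (hz : 0 < z) :
    remainderK N z ν = (-1) ^ N * reprConst ν / z ^ N *
      kernelIntegral N (fun t => (1 + t / z)⁻¹) ν := by
  obtain ⟨h1, h2, h3⟩ := stieltjesKernel_bounds hz
  have hL : AnalyticOnNhd ℝ (fun ν => remainderK N z ν) (Ioo (-((N : ℝ) + 1 / 2)) (N + 1 / 2)) := by
    intro x _
    have hK : AnalyticAt ℝ (fun ν => besselK ν z) x := analyticOnNhd_besselK hz x (mem_univ x)
    unfold remainderK coeffA
    have hP : AnalyticAt ℝ (fun ν => ∑ n ∈ Finset.range N,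
        (∏ k ∈ Finset.range n, (4 * ν ^ 2 - (2 * (k : ℝ) + 1) ^ 2)) / (8 ^ n * (n.factorial : ℝ))
          / z ^ n) x := by
      refine Finset.analyticAt_fun_sum _ fun n _ => ?_
      refine AnalyticAt.fun_div (AnalyticAt.fun_div ?_ analyticAt_const (by positivity))
        analyticAt_const (by positivity)
      exact Finset.analyticAt_fun_prod _ fun k _ => by fun_prop
    refine AnalyticAt.fun_sub (AnalyticAt.fun_div hK analyticAt_const ?_) hP
    positivity
  have hR : AnalyticOnNhd ℝ (fun ν => (-1) ^ N * reprConst ν / z ^ N *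
      kernelIntegral N (fun t => (1 + t / z)⁻¹) ν) (Ioo (-((N : ℝ) + 1 / 2)) (N + 1 / 2)) := by
    intro x hx
    refine AnalyticAt.fun_mul ?_ ((kernelIntegral_spec h1 h2 h3 N).2 x hx)
    unfold reprConst
    have : AnalyticAt ℝ (fun ν => Real.cos (Real.pi * ν)) x :=
      Real.analyticAt_cos.fun_comp (by fun_prop)
    have hz' : z ^ N ≠ 0 := by positivity
    exact AnalyticAt.fun_div (AnalyticAt.fun_mul analyticAt_const
      (AnalyticAt.fun_mul (AnalyticAt.fun_div this analyticAt_const Real.pi_ne_zero)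
        analyticAt_const)) analyticAt_const hz'
  refine hL.eqOn_of_preconnected_of_eventuallyEq hR isPreconnected_Ioo (z₀ := 0)
    ⟨by linarith, by linarith⟩ ?_ hν
  filter_upwards [Ioo_mem_nhds (show (-(1 / 2) : ℝ) < 0 by norm_num)
    (show (0 : ℝ) < 1 / 2 by norm_num)] with x hx
  exact remainderK_eq_of_lt_half (abs_lt.2 hx) hz N

theorem coeffA_eq_moment {ν : ℝ} {n : ℕ} (hν : ν ∈ Ioo (-((n : ℝ) + 1 / 2)) (n + 1 / 2)) :
    coeffA n ν = (-1) ^ n * reprConst ν * kernelIntegral n (fun _ => 1) ν := by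
  have e : coeffA n ν = remainderK n 1 ν - remainderK (n + 1) 1 ν := by
    simp only [remainderK, Finset.sum_range_succ]; ring
  rw [e, remainderK_eq hν one_pos,
    remainderK_eq ⟨by push_cast; linarith [hν.1], by push_cast; linarith [hν.2]⟩ one_pos,
    moment_eq_add n hν one_pos]
  ring

/-! ### Power series: `K_ν` in terms of `I_ν` and `I_{-ν}` -/

theorem continuous_inv_Gamma : Continuous fun s : ℝ => (Real.Gamma s)⁻¹ := by
  have h : Continuous fun s : ℝ => ((Complex.Gamma (s : ℂ))⁻¹).re :=
    Complex.continuous_re.comp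
      (Complex.differentiable_one_div_Gamma.continuous.comp Complex.continuous_ofReal)
  refine h.congr fun s => ?_
  rw [Complex.Gamma_ofReal, ← Complex.ofReal_inv, Complex.ofReal_re]

/-- `1/Γ` is bounded on half-lines: it is continuous, and `Γ(s) = (s-1) Γ(s-1)` bounds it for
`s > 2` by its values at smaller arguments. -/
theorem exists_inv_Gamma_bound (L : ℝ) : ∃ C, 0 ≤ C ∧ ∀ s, -L ≤ s → |(Real.Gamma s)⁻¹| ≤ C := by
  obtain ⟨C, hC⟩ := (isCompact_Icc (a := min (-L) 1) (b := 2)).exists_bound_of_continuousOn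
    continuous_inv_Gamma.continuousOn
  have key : ∀ n : ℕ, ∀ s, min (-L) 1 ≤ s → s ≤ 2 + n → |(Real.Gamma s)⁻¹| ≤ |C| := by
    intro n
    induction n with
    | zero => exact fun s h1 h2 => (hC s ⟨h1, by simpa using h2⟩).trans (le_abs_self C)
    | succ n ih =>
      intro s h1 h2
      by_cases hs : s ≤ 2
      · exact (hC s ⟨h1, hs⟩).trans (le_abs_self C)
      · push Not at hs
        push_cast at h2
        have h3 := ih (s - 1) ((min_le_right _ _).trans (by linarith)) (by linarith)
        have h4 : Real.Gamma s = (s - 1) * Real.Gamma (s - 1) := by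
          rw [← Real.Gamma_add_one (by linarith)]; simp
        rw [h4, mul_inv, abs_mul, abs_inv, abs_of_pos (show (0 : ℝ) < s - 1 by linarith)]
        exact (mul_le_of_le_one_left (abs_nonneg _) (inv_le_one_of_one_le₀ (by linarith))).trans h3
  refine ⟨|C|, abs_nonneg C, fun s hs => ?_⟩
  obtain ⟨n, hn⟩ := exists_nat_ge (s - 2)
  exact key n s ((min_le_left _ _).trans hs) (by linarith)

/-- The entire function `∑ x^k / (k! Γ(ν+k+1))`, so that `J_ν(x) = (x/2)^ν besselS ν (-x²/4)`. -/
def besselS (ν : ℝ) (x : ℂ) : ℂ :=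
  ∑' k : ℕ, (((k.factorial : ℝ)⁻¹ * (Real.Gamma (ν + k + 1))⁻¹ : ℝ) : ℂ) * x ^ k

/-- The restriction of `besselS` to the real line. -/
def besselSReal (ν x : ℝ) : ℝ :=
  ∑' k : ℕ, (k.factorial : ℝ)⁻¹ * (Real.Gamma (ν + k + 1))⁻¹ * x ^ k

theorem besselS_ofReal (ν x : ℝ) : besselS ν (x : ℂ) = besselSReal ν x := by
  rw [besselS, besselSReal, Complex.ofReal_tsum]
  push_cast
  rfl

/-- A bound for the coefficients of `besselS μ`, uniform for `μ` near `ν`. -/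
theorem exists_coeff_bound (ν : ℝ) : ∃ C, 0 ≤ C ∧ ∀ μ, ν - 1 ≤ μ → ∀ k : ℕ,
    |(k.factorial : ℝ)⁻¹ * (Real.Gamma (μ + k + 1))⁻¹| ≤ C * (k.factorial : ℝ)⁻¹ := by
  obtain ⟨C, hC0, hC⟩ := exists_inv_Gamma_bound (-ν)
  refine ⟨C, hC0, fun μ hμ k => ?_⟩
  rw [abs_mul, abs_of_nonneg (by positivity), mul_comm]
  gcongr
  exact hC _ (by linarith)

theorem summable_coeff_mul (C R : ℝ) :
    Summable fun k : ℕ => C * (k.factorial : ℝ)⁻¹ * R ^ k := by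
  refine ((Real.summable_pow_div_factorial R).mul_left C).congr fun k => ?_
  ring

theorem summable_besselS (ν : ℝ) (x : ℂ) : Summable fun k : ℕ =>
    (((k.factorial : ℝ)⁻¹ * (Real.Gamma (ν + k + 1))⁻¹ : ℝ) : ℂ) * x ^ k := by
  obtain ⟨C, hC0, hC⟩ := exists_coeff_bound ν
  refine Summable.of_norm_bounded (summable_coeff_mul C ‖x‖) fun k => ?_
  rw [norm_mul, norm_pow, Complex.norm_real, Real.norm_eq_abs]
  gcongr
  exact hC ν (by linarith) k

theorem hasDerivAt_besselS (ν : ℝ) (x : ℂ) : HasDerivAt (besselS ν) (besselS (ν + 1) x) x := by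
  obtain ⟨C, hC0, hC⟩ := exists_coeff_bound ν
  set c : ℕ → ℝ := fun k => (k.factorial : ℝ)⁻¹ * (Real.Gamma (ν + k + 1))⁻¹ with hc
  set R : ℝ := ‖x‖ + 1 with hR
  have hu : Summable fun k : ℕ => C * (k.factorial : ℝ)⁻¹ * (k * R ^ (k - 1)) := by
    rw [← summable_nat_add_iff 1]
    refine (summable_coeff_mul C R).congr fun k => ?_
    rw [Nat.factorial_succ]
    push_cast
    field_simp
  have h := hasDerivAt_tsum_of_isPreconnected (𝕜 := ℂ) (y₀ := x) (y := x)
    (g := fun k y => (c k : ℂ) * y ^ k) (g' := fun k y => (c k : ℂ) * (k * y ^ (k - 1)))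
    hu Metric.isOpen_ball (Metric.isPreconnected_ball (x := (0 : ℂ)) (r := R))
    (fun k y _ => (hasDerivAt_pow k y).const_mul _) ?_ (by simp [hR])
    (summable_besselS ν x) (by simp [hR])
  · refine h.congr_deriv ?_
    have hs : Summable fun k : ℕ => (c k : ℂ) * (k * x ^ (k - 1)) := by
      refine Summable.of_norm_bounded hu fun k => ?_
      simp only [norm_mul, norm_pow, Complex.norm_real, Real.norm_eq_abs, Complex.norm_natCast]
      gcongr
      · exact hC ν (by linarith) k
      · linarith
    rw [hs.tsum_eq_zero_add, besselS]
    simp only [Nat.cast_zero, zero_mul, mul_zero, zero_add]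
    refine tsum_congr fun k => ?_
    rw [Nat.add_sub_cancel, ← mul_assoc, hc]
    congr 1
    dsimp only
    rw [Nat.factorial_succ, show ν + ((k + 1 : ℕ) : ℝ) + 1 = ν + 1 + k + 1 by push_cast; ring]
    push_cast
    field_simp
  · intro k y hy
    have hy' : ‖y‖ ≤ R := by simpa using (mem_ball_zero_iff.1 hy).le
    simp only [norm_mul, norm_pow, Complex.norm_real, Real.norm_eq_abs, Complex.norm_natCast]
    gcongr
    exact hC ν (by linarith) k

theorem hasDerivAt_besselSReal (ν x : ℝ) :
    HasDerivAt (besselSReal ν) (besselSReal (ν + 1) x) x := by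
  have h := (hasDerivAt_besselS ν (x : ℂ)).real_of_complex
  simpa only [besselS_ofReal, Complex.ofReal_re] using h

theorem summable_besselSReal (ν x : ℝ) : Summable fun k : ℕ =>
    (k.factorial : ℝ)⁻¹ * (Real.Gamma (ν + k + 1))⁻¹ * x ^ k := by
  obtain ⟨C, hC0, hC⟩ := exists_coeff_bound ν
  refine Summable.of_norm_bounded (summable_coeff_mul C |x|) fun k => ?_
  rw [norm_mul, norm_pow, Real.norm_eq_abs, Real.norm_eq_abs]
  gcongr
  exact hC ν (by linarith) k

theorem besselSReal_sub_one (ν x : ℝ) :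
    besselSReal (ν - 1) x = ν * besselSReal ν x + x * besselSReal (ν + 1) x := by
  have h0 := summable_besselSReal (ν - 1) x
  have h1 := (summable_besselSReal ν x).mul_left ν
  have h2 := (summable_besselSReal (ν + 1) x).mul_left x
  -- valid also at the poles, where `Real.Gamma` and hence its inverse are `0`
  have hΓ : ∀ s : ℝ, (Real.Gamma s)⁻¹ = s * (Real.Gamma (s + 1))⁻¹ := fun s => by
    rcases eq_or_ne s 0 with rfl | hs
    · simp
    · rw [Real.Gamma_add_one hs, mul_inv, mul_inv_cancel_left₀ hs]
  simp only [besselSReal]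
  rw [← tsum_mul_left, ← tsum_mul_left, h0.tsum_eq_zero_add, h1.tsum_eq_zero_add, add_assoc (ν * _),
    ← ((summable_nat_add_iff 1).2 h1).tsum_add h2]
  congr 1
  · simp only [Nat.cast_zero, add_zero, Nat.factorial_zero, Nat.cast_one, inv_one, one_mul,
      pow_zero, mul_one, sub_add_cancel]
    exact hΓ ν
  · refine tsum_congr fun k => ?_
    rw [hΓ (ν - 1 + ((k + 1 : ℕ) : ℝ) + 1), Nat.factorial_succ,
      show ν - 1 + ((k + 1 : ℕ) : ℝ) + 1 = ν + k + 1 by push_cast; ring,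
      show ν + ((k + 1 : ℕ) : ℝ) + 1 = ν + k + 1 + 1 by push_cast; ring,
      show ν + 1 + k + 1 = ν + k + 1 + 1 by ring]
    push_cast
    field_simp
    ring

theorem besselSReal_zero (ν : ℝ) : besselSReal ν 0 = (Real.Gamma (ν + 1))⁻¹ := by
  rw [besselSReal, tsum_eq_single 0 fun k hk => by simp [hk]]
  simp

theorem continuous_besselSReal_order (x : ℝ) : Continuous fun ν => besselSReal ν x := by
  refine continuous_iff_continuousAt.2 fun ν => ?_
  obtain ⟨C, hC0, hC⟩ := exists_coeff_bound ν
  refine tendsto_tsum_of_dominated_convergence (summable_coeff_mul C |x|) (fun k => ?_) ?_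
  · have : Continuous fun μ : ℝ => (k.factorial : ℝ)⁻¹ * (Real.Gamma (μ + k + 1))⁻¹ * x ^ k :=
      (continuous_const.mul (continuous_inv_Gamma.comp (by fun_prop))).mul continuous_const
    exact this.tendsto ν
  · filter_upwards [Ioi_mem_nhds (show ν - 1 < ν by linarith)] with μ hμ k
    rw [norm_mul, norm_pow, Real.norm_eq_abs, Real.norm_eq_abs]
    gcongr
    exact hC μ (le_of_lt hμ) k

theorem besselJ_eq_besselSReal (ν : ℝ) {x : ℝ} (hx : 0 < x) :
    besselJ ν x = (x / 2) ^ ν * besselSReal ν (-(x ^ 2 / 4)) := by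
  rw [besselJ, besselSReal, ← tsum_mul_left]
  refine tsum_congr fun k => ?_
  have h : (x / 2) ^ (2 * (k : ℝ) + ν) = (x / 2) ^ ν * (x ^ 2 / 4) ^ k := by
    rw [Real.rpow_add (by positivity), mul_comm, Real.rpow_mul (by positivity), Real.rpow_natCast]
    congr 2
    norm_num
    ring
  rw [h, neg_pow (x ^ 2 / 4), div_eq_mul_inv, mul_inv]
  ring

theorem continuous_besselJ_order {x : ℝ} (hx : 0 < x) : Continuous fun ν => besselJ ν x := by
  simp only [besselJ_eq_besselSReal _ hx]
  have h : Continuous fun ν : ℝ => (x / 2) ^ ν :=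
    Real.continuous_const_rpow (by positivity)
  exact h.mul (continuous_besselSReal_order _)

/-- The difference of `besselG ν` and the combination of power series which it is shown to equal
in `besselG_eq`. -/
def besselDefect (ν x : ℝ) : ℝ :=
  besselG ν x -
    Real.pi / Real.sin (Real.pi * ν) * (besselSReal (-ν) x - x ^ ν * besselSReal ν x)

theorem besselDefect_neg (ν : ℝ) {x : ℝ} (hx : 0 < x) :
    besselDefect (-ν) x = x ^ (-ν) * besselDefect ν x := by
  have h : x ^ (-ν) * x ^ ν = 1 := by rw [← Real.rpow_add hx]; simp
  rw [besselDefect, besselDefect, besselG_neg ν hx, neg_neg, mul_neg, Real.sin_neg, div_neg]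
  linear_combination (-Real.pi / Real.sin (Real.pi * ν) * besselSReal ν x) * h

theorem hasDerivAt_besselDefect (ν : ℝ) {x : ℝ} (hx : 0 < x) :
    HasDerivAt (besselDefect ν) (-besselDefect (ν - 1) x) x := by
  have h := (hasDerivAt_besselG ν hx).sub (((hasDerivAt_besselSReal (-ν) x).sub
    ((Real.hasDerivAt_rpow_const (p := ν) (Or.inl hx.ne')).mul
      (hasDerivAt_besselSReal ν x))).const_mul (Real.pi / Real.sin (Real.pi * ν)))
  refine h.congr_deriv ?_
  have e1 : Real.sin (Real.pi * (ν - 1)) = -Real.sin (Real.pi * ν) := by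
    rw [mul_sub, mul_one, Real.sin_sub_pi]
  rw [besselDefect, e1, besselSReal_sub_one, show -(ν - 1) = -ν + 1 by ring,
    Real.rpow_sub_one hx.ne']
  field_simp
  ring

theorem tendsto_besselDefect {ν : ℝ} (h0 : 0 < ν) (h1 : ν < 1) :
    Tendsto (besselDefect ν) (𝓝[>] 0) (𝓝 0) := by
  have hS : ∀ μ, Tendsto (besselSReal μ) (𝓝[>] 0) (𝓝 (Real.Gamma (μ + 1))⁻¹) := fun μ => by
    rw [← besselSReal_zero]
    exact (hasDerivAt_besselSReal μ 0).continuousAt.tendsto.mono_left nhdsWithin_le_nhds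
  have hx : Tendsto (fun x : ℝ => x ^ ν) (𝓝[>] 0) (𝓝 0) := by
    have h := (Real.continuousAt_rpow_const 0 ν (Or.inr h0.le)).tendsto
    rw [Real.zero_rpow h0.ne'] at h
    exact h.mono_left nhdsWithin_le_nhds
  have h := (tendsto_besselG h0).sub (((hS (-ν)).sub (hx.mul (hS ν))).const_mul
    (Real.pi / Real.sin (Real.pi * ν)))
  refine h.trans (le_of_eq ?_)
  congr 1
  have hG := Real.Gamma_pos_of_pos (s := 1 - ν) (by linarith)
  rw [← Real.Gamma_mul_Gamma_one_sub, neg_add_eq_sub]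
  field_simp
  ring

/-- For `0 < ν < 1` the functions `u = besselDefect ν` and `v = besselDefect (1 - ν)` satisfy
`u' = -x^(ν-1) v`, `v' = -x^(-ν) u` and vanish at `0`. The coefficients are integrable at `0`, and
a Grönwall argument gives `u = 0`. -/
theorem besselDefect_eq_zero_of_mem_Ioo {ν x : ℝ} (h0 : 0 < ν) (h1 : ν < 1) (hx : 0 < x) :
    besselDefect ν x = 0 := by
  have h2 : 0 < 1 - ν := by linarith
  set E : ℝ → ℝ := fun y => Real.exp (-(y ^ ν / ν + y ^ (1 - ν) / (1 - ν))) with hE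
  set h : ℝ → ℝ := fun y => (besselDefect ν y ^ 2 + besselDefect (1 - ν) y ^ 2) * E y with hh
  -- `(u² + v²)' = -2uv (y^(ν-1) + y^(-ν))`, so the factor `E` makes `h'` minus a square
  have hd : ∀ y ∈ Ioi (0 : ℝ), HasDerivAt h (-(E y * (y ^ (ν - 1) + y ^ (-ν)) *
      (besselDefect ν y + besselDefect (1 - ν) y) ^ 2)) y := by
    intro y hy
    simp only [mem_Ioi] at hy
    have du := hasDerivAt_besselDefect ν hy
    have dv := hasDerivAt_besselDefect (1 - ν) hy
    rw [show ν - 1 = -(1 - ν) by ring, besselDefect_neg _ hy] at du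
    rw [show 1 - ν - 1 = -ν by ring, besselDefect_neg _ hy] at dv
    have dp1 := (Real.hasDerivAt_rpow_const (x := y) (p := ν) (Or.inl hy.ne')).div_const ν
    have dp2 := (Real.hasDerivAt_rpow_const (x := y) (p := 1 - ν)
      (Or.inl hy.ne')).div_const (1 - ν)
    refine (((du.pow 2).add (dv.pow 2)).mul ((dp1.add dp2).neg.exp)).congr_deriv ?_
    rw [mul_div_cancel_left₀ _ h0.ne', mul_div_cancel_left₀ _ h2.ne',
      show 1 - ν - 1 = -ν by ring, show -(1 - ν) = ν - 1 by ring]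
    simp only [hE, Pi.add_apply, Pi.pow_apply, Pi.neg_apply]
    push_cast
    ring
  have hanti : AntitoneOn h (Ioi 0) := by
    refine antitoneOn_of_deriv_nonpos (convex_Ioi 0)
      (fun y hy => (hd y hy).continuousAt.continuousWithinAt) ?_ ?_
    · rw [interior_Ioi]
      exact fun y hy => (hd y hy).differentiableAt.differentiableWithinAt
    · rw [interior_Ioi]
      intro y hy
      rw [(hd y hy).deriv]
      simp only [mem_Ioi] at hy
      have : 0 ≤ E y * (y ^ (ν - 1) + y ^ (-ν)) *
        (besselDefect ν y + besselDefect (1 - ν) y) ^ 2 := by positivity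
      linarith
  have hl : Tendsto (fun y => besselDefect ν y ^ 2 + besselDefect (1 - ν) y ^ 2) (𝓝[>] 0)
      (𝓝 0) := by
    simpa using ((tendsto_besselDefect h0 h1).pow 2).add
      ((tendsto_besselDefect h2 (by linarith)).pow 2)
  have hle : h x ≤ 0 := by
    refine ge_of_tendsto hl ?_
    filter_upwards [Ioo_mem_nhdsGT hx] with y hy
    refine (hanti hy.1 hx hy.2.le).trans ?_
    refine mul_le_of_le_one_right (by positivity) (Real.exp_le_one_iff.2 ?_)
    have := hy.1
    have : 0 ≤ y ^ ν / ν + y ^ (1 - ν) / (1 - ν) := by positivity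
    linarith
  have hE0 : 0 < E x := Real.exp_pos _
  have := nonpos_of_mul_nonpos_left hle hE0
  nlinarith [sq_nonneg (besselDefect ν x), sq_nonneg (besselDefect (1 - ν) x)]

theorem besselDefect_eq_zero {ν x : ℝ} (hν : ∀ n : ℤ, (n : ℝ) ≠ ν) (hx : 0 < x) :
    besselDefect ν x = 0 := by
  -- `besselDefect (μ - 1) = -(besselDefect μ)'` carries the vanishing from `(0, 1)` to negative `μ`
  have step : ∀ a : ℝ, 0 < a → a < 1 → ∀ n : ℕ, ∀ y, 0 < y → besselDefect (a - n) y = 0 := by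
    intro a h0 h1 n
    induction n with
    | zero => exact fun y hy => by simpa using besselDefect_eq_zero_of_mem_Ioo h0 h1 hy
    | succ n ih =>
      intro y hy
      have hd := hasDerivAt_besselDefect (a - n) hy
      have hz : HasDerivAt (besselDefect (a - n)) 0 y := by
        refine (hasDerivAt_const y (0 : ℝ)).congr_of_eventuallyEq ?_
        filter_upwards [Ioi_mem_nhds hy] with w hw using ih w hw
      have := hd.unique hz
      rw [show a - ((n + 1 : ℕ) : ℝ) = a - n - 1 by push_cast; ring]
      linarith
  have neg : ∀ μ : ℝ, (∀ n : ℤ, (n : ℝ) ≠ μ) → μ < 0 → ∀ y, 0 < y → besselDefect μ y = 0 := by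
    intro μ hμ hμ0 y hy
    have hf : 0 < Int.fract μ := by
      refine lt_of_le_of_ne (Int.fract_nonneg μ) fun h => hμ ⌊μ⌋ ?_
      have := Int.self_sub_floor μ
      linarith
    obtain ⟨n, hn⟩ := Int.eq_ofNat_of_zero_le
      (show 0 ≤ -⌊μ⌋ by have := Int.floor_nonpos hμ0.le; omega)
    have h := step _ hf (Int.fract_lt_one μ) n y hy
    have e : Int.fract μ - n = μ := by
      have h1 : ((-⌊μ⌋ : ℤ) : ℝ) = n := by rw [hn]; simp
      push_cast at h1
      have := Int.self_sub_floor μ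
      linarith
    rwa [e] at h
  rcases lt_trichotomy ν 0 with h | h | h
  · exact neg ν hν h x hx
  · exact absurd h.symm (by simpa using hν 0)
  · have h' := neg (-ν) (fun n hn => hν (-n) (by push_cast; linarith)) (by linarith) x hx
    rw [besselDefect_neg ν hx] at h'
    exact (mul_eq_zero.1 h').resolve_left (Real.rpow_pos_of_pos hx _).ne'

/-- `K_ν = (π/2) (I_{-ν} - I_ν) / sin(πν)`, with the power series of the functions `I_{±ν}`. -/
theorem besselK_eq_besselSReal {ν z : ℝ} (hν : ∀ n : ℤ, (n : ℝ) ≠ ν) (hz : 0 < z) :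
    besselK ν z = Real.pi / (2 * Real.sin (Real.pi * ν)) *
      ((z / 2) ^ (-ν) * besselSReal (-ν) (z ^ 2 / 4)
        - (z / 2) ^ ν * besselSReal ν (z ^ 2 / 4)) := by
  have h := besselDefect_eq_zero hν (x := z ^ 2 / 4) (by positivity)
  rw [besselDefect, (hasInt_besselK_univ ν hz).2, sub_eq_zero] at h
  have hz2 : 0 < z / 2 := half_pos hz
  have e : (z ^ 2 / 4) ^ ν = (z / 2) ^ ν * (z / 2) ^ ν := by
    rw [← Real.mul_rpow hz2.le hz2.le]; congr 1; ring
  have h2 : besselK ν z = ((z / 2) ^ ν)⁻¹ / 2 * (2 * (z / 2) ^ ν * besselK ν z) := by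
    field_simp
  rw [h2, h, e, Real.rpow_neg hz2.le]
  field_simp

/-! ### Continuation in the variable: the remainders `R_N^{(J)}` as integral transforms -/

/-- An open half-plane which contains the positive real and the negative imaginary half-axis. -/
def tiltedHalfPlane : Set ℂ := {w | w.im < w.re}

theorem isOpen_tiltedHalfPlane : IsOpen tiltedHalfPlane :=
  isOpen_lt Complex.continuous_im Complex.continuous_re

theorem isPreconnected_tiltedHalfPlane : IsPreconnected tiltedHalfPlane := by
  refine Convex.isPreconnected ?_
  intro x hx y hy a b ha hb hab
  simp only [tiltedHalfPlane, mem_ofPred_eq] at hx hy ⊢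
  simp only [Complex.add_re, Complex.add_im, Complex.real_smul, Complex.mul_re, Complex.mul_im,
    Complex.ofReal_re, Complex.ofReal_im, zero_mul, sub_zero, add_zero]
  rcases ha.eq_or_lt with rfl | ha
  · have : b = 1 := by linarith
    subst this; linarith
  · nlinarith [mul_nonneg hb (sub_nonneg.2 hy.le), mul_pos ha (sub_pos.2 hx)]

theorem tiltedHalfPlane_subset_slitPlane : tiltedHalfPlane ⊆ Complex.slitPlane := by
  intro w hw
  simp only [tiltedHalfPlane, mem_ofPred_eq] at hw
  rw [Complex.mem_slitPlane_iff]
  by_cases h : w.im = 0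
  · left; linarith
  · exact Or.inr h

theorem norm_add_ge {w : ℂ} {t : ℝ} (ht : 0 < t) : (w.re - w.im) / 2 ≤ ‖w + t‖ := by
  have h1 := Complex.abs_re_le_norm (w + t)
  have h2 := Complex.abs_im_le_norm (w + t)
  simp only [Complex.add_re, Complex.add_im, Complex.ofReal_re, Complex.ofReal_im,
    add_zero] at h1 h2
  have h3 := le_abs_self (w.re + t)
  have h4 := neg_abs_le w.im
  linarith

/-- A Stieltjes transform is holomorphic off the negative half-axis; the half-plane
`tiltedHalfPlane` is enough here. -/
theorem differentiableOn_stieltjes {m : ℝ → ℝ} (hm : IntegrableOn m (Ioi 0)) :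
    DifferentiableOn ℂ (fun w : ℂ => ∫ t in Ioi (0 : ℝ), (m t : ℂ) / (w + t)) tiltedHalfPlane := by
  intro w hw
  simp only [tiltedHalfPlane, mem_ofPred_eq] at hw
  set d := (w.re - w.im) / 4 with hd
  have hd0 : 0 < d := by rw [hd]; linarith
  have hmc : Integrable (fun t => (m t : ℂ)) (volume.restrict (Ioi 0)) := hm.ofReal
  have hmeas : ∀ x : ℂ, AEStronglyMeasurable (fun t : ℝ => (m t : ℂ) / (x + t))
      (volume.restrict (Ioi 0)) := fun x =>
    hmc.aestronglyMeasurable.mul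
      (by fun_prop : Measurable fun t : ℝ => (x + (t : ℂ))⁻¹).aestronglyMeasurable
  have hnbhd : {x : ℂ | 2 * d < x.re - x.im} ∈ 𝓝 w :=
    (isOpen_lt continuous_const (Complex.continuous_re.sub Complex.continuous_im)).mem_nhds
      (by change 2 * d < w.re - w.im; rw [hd]; linarith)
  have hlow : ∀ x ∈ {x : ℂ | 2 * d < x.re - x.im}, ∀ t ∈ Ioi (0 : ℝ), d ≤ ‖x + t‖ :=
    fun x hx t ht => by
      simp only [mem_ofPred_eq] at hx
      exact le_trans (by linarith) (norm_add_ge (w := x) ht)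
  have key := hasDerivAt_integral_of_dominated_loc_of_deriv_le
    (μ := volume.restrict (Ioi (0 : ℝ))) (x₀ := w) (s := {x : ℂ | 2 * d < x.re - x.im})
    (F := fun x t => (m t : ℂ) / (x + t)) (F' := fun x t => -(m t : ℂ) / (x + t) ^ 2)
    (bound := fun t => |m t| * (d ^ 2)⁻¹) hnbhd (Eventually.of_forall hmeas) ?_ ?_ ?_ ?_ ?_
  · exact key.2.differentiableAt.differentiableWithinAt
  · refine Integrable.mono' ((hm.abs).mul_const d⁻¹) (hmeas w) ?_
    refine (ae_restrict_iff' measurableSet_Ioi).2 (Eventually.of_forall fun t ht => ?_)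
    rw [norm_div, Complex.norm_real, Real.norm_eq_abs, div_eq_mul_inv]
    gcongr
    exact hlow w (mem_of_mem_nhds hnbhd) t ht
  · exact hmc.aestronglyMeasurable.neg.mul
      (by fun_prop : Measurable fun t : ℝ => ((w + (t : ℂ)) ^ 2)⁻¹).aestronglyMeasurable
  · refine (ae_restrict_iff' measurableSet_Ioi).2 (Eventually.of_forall fun t ht x hx => ?_)
    rw [norm_div, norm_neg, Complex.norm_real, Real.norm_eq_abs, div_eq_mul_inv, norm_pow]
    gcongr
    exact hlow x hx t ht
  · exact (hm.abs).mul_const _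
  · refine (ae_restrict_iff' measurableSet_Ioi).2 (Eventually.of_forall fun t ht x hx => ?_)
    have h0 : x + t ≠ 0 := norm_pos_iff.1 (hd0.trans_le (hlow x hx t ht))
    have h := ((hasDerivAt_id x).add_const (t : ℂ)).inv h0 |>.const_mul (m t : ℂ)
    refine h.congr_deriv ?_
    simp only [id]
    ring

theorem hasInt_moment {ν : ℝ} {N : ℕ} (hν : ν ∈ Ioo (-((N : ℝ) + 1 / 2)) (N + 1 / 2)) :
    HasInt (Ioi 0) (fun t => t ^ N * weightK ν t) (kernelIntegral N (fun _ => 1) ν) :=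
  ((kernelIntegral_spec (κ := fun _ => 1) measurable_const (fun _ _ => zero_le_one)
    (fun _ _ => le_rfl) N).1 ν hν).congr measurableSet_Ioi (fun _ _ => mul_one _) rfl

/-- The analytic continuation of `remainderK_eq`, with `K_ν` written through `besselS`, to
complex values of the variable. -/
theorem besselS_eq_stieltjes {ν : ℝ} {N : ℕ} (hν : ν ∈ Ioo (-((N : ℝ) + 1 / 2)) (N + 1 / 2))
    (hint : ∀ n : ℤ, (n : ℝ) ≠ ν) {w : ℂ} (hw : w ∈ tiltedHalfPlane) :
    (Real.sqrt (2 / Real.pi) : ℂ) * w ^ (1 / 2 : ℂ) * Complex.exp w *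
        ((Real.pi / (2 * Real.sin (Real.pi * ν)) : ℝ) *
          ((w / 2) ^ (-(ν : ℂ)) * besselS (-ν) (w ^ 2 / 4)
            - (w / 2) ^ (ν : ℂ) * besselS ν (w ^ 2 / 4)))
      = (∑ n ∈ Finset.range N, (coeffA n ν : ℂ) / w ^ n) +
        (-1) ^ N * (reprConst ν : ℂ) / w ^ N *
          (w * ∫ t in Ioi (0 : ℝ), ((t ^ N * weightK ν t : ℝ) : ℂ) / (w + t)) := by
  have hU : ∀ x ∈ tiltedHalfPlane, x ∈ Complex.slitPlane := fun x hx =>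
    tiltedHalfPlane_subset_slitPlane hx
  have hU2 : ∀ x ∈ tiltedHalfPlane, x / 2 ∈ Complex.slitPlane := fun x hx => by
    apply tiltedHalfPlane_subset_slitPlane
    simp only [tiltedHalfPlane, mem_ofPred_eq] at hx ⊢
    simp only [Complex.div_ofNat_re, Complex.div_ofNat_im]
    linarith
  have hne : ∀ x ∈ tiltedHalfPlane, x ≠ 0 := fun x hx => Complex.slitPlane_ne_zero (hU x hx)
  have hS : ∀ μ : ℝ, Differentiable ℂ fun x : ℂ => besselS μ (x ^ 2 / 4) := fun μ x =>
    DifferentiableAt.comp x (hasDerivAt_besselS μ _).differentiableAt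
      (by fun_prop : DifferentiableAt ℂ (fun x : ℂ => x ^ 2 / 4) x)
  have hd1 : ∀ s : ℂ, DifferentiableOn ℂ (fun x : ℂ => (x / 2) ^ s) tiltedHalfPlane :=
    fun _ x hx => ((by fun_prop : DifferentiableAt ℂ (fun x : ℂ => x / 2) x).cpow_const
      (hU2 x hx)).differentiableWithinAt
  have hd2 : DifferentiableOn ℂ (fun x : ℂ => x ^ (1 / 2 : ℂ)) tiltedHalfPlane :=
    fun x hx => (differentiableAt_id.cpow_const (hU x hx)).differentiableWithinAt
  have hL : DifferentiableOn ℂ (fun w : ℂ =>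
      (Real.sqrt (2 / Real.pi) : ℂ) * w ^ (1 / 2 : ℂ) * Complex.exp w *
        ((Real.pi / (2 * Real.sin (Real.pi * ν)) : ℝ) *
          ((w / 2) ^ (-(ν : ℂ)) * besselS (-ν) (w ^ 2 / 4)
            - (w / 2) ^ (ν : ℂ) * besselS ν (w ^ 2 / 4)))) tiltedHalfPlane :=
    ((hd2.const_mul _).mul Complex.differentiable_exp.differentiableOn).mul
      ((((hd1 _).mul (hS (-ν)).differentiableOn).sub
        ((hd1 _).mul (hS ν).differentiableOn)).const_mul _)
  have hR : DifferentiableOn ℂ (fun w : ℂ =>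
      (∑ n ∈ Finset.range N, (coeffA n ν : ℂ) / w ^ n) +
        (-1) ^ N * (reprConst ν : ℂ) / w ^ N *
          (w * ∫ t in Ioi (0 : ℝ), ((t ^ N * weightK ν t : ℝ) : ℂ) / (w + t)))
      tiltedHalfPlane := by
    have hp : ∀ (c : ℂ) (n : ℕ), DifferentiableOn ℂ (fun w : ℂ => c / w ^ n) tiltedHalfPlane :=
      fun c n => DifferentiableOn.fun_div (by fun_prop) (by fun_prop)
        fun x hx => pow_ne_zero n (hne x hx)
    exact (DifferentiableOn.fun_sum fun n _ => hp _ n).fun_add ((hp _ N).fun_mul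
      (differentiableOn_id.fun_mul (differentiableOn_stieltjes (hasInt_moment hν).1)))
  refine (hL.analyticOnNhd isOpen_tiltedHalfPlane).eqOn_of_preconnected_of_frequently_eq
    (hR.analyticOnNhd isOpen_tiltedHalfPlane) isPreconnected_tiltedHalfPlane (z₀ := 1)
    (by simp [tiltedHalfPlane]) ?_ hw
  have hreal : ∀ z : ℝ, 0 < z →
      (Real.sqrt (2 / Real.pi) : ℂ) * (z : ℂ) ^ (1 / 2 : ℂ) * Complex.exp z *
        ((Real.pi / (2 * Real.sin (Real.pi * ν)) : ℝ) *
          (((z : ℂ) / 2) ^ (-(ν : ℂ)) * besselS (-ν) ((z : ℂ) ^ 2 / 4)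
            - ((z : ℂ) / 2) ^ (ν : ℂ) * besselS ν ((z : ℂ) ^ 2 / 4)))
      = (∑ n ∈ Finset.range N, (coeffA n ν : ℂ) / (z : ℂ) ^ n) +
        (-1) ^ N * (reprConst ν : ℂ) / (z : ℂ) ^ N *
          ((z : ℂ) * ∫ t in Ioi (0 : ℝ), ((t ^ N * weightK ν t : ℝ) : ℂ) / ((z : ℂ) + t)) := by
    intro z hz
    have hI : (∫ t in Ioi (0 : ℝ), ((t ^ N * weightK ν t : ℝ) : ℂ) / ((z : ℂ) + t))
        = ((z⁻¹ * kernelIntegral N (fun t => (1 + t / z)⁻¹) ν : ℝ) : ℂ) := by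
      rw [kernelIntegral, ← integral_const_mul, ← integral_complex_ofReal]
      refine setIntegral_congr_fun measurableSet_Ioi fun t ht => ?_
      simp only [mem_Ioi] at ht
      have h2 : (z : ℂ) ≠ 0 := by exact_mod_cast hz.ne'
      push_cast
      field_simp
    have hK := remainderK_eq hν hz
    have hs : besselK ν z / (Real.sqrt (Real.pi / (2 * z)) * Real.exp (-z))
        = Real.sqrt (2 / Real.pi) * z ^ (1 / 2 : ℝ) * Real.exp z * besselK ν z := by
      have hpi := Real.pi_pos
      rw [← Real.sqrt_eq_rpow, Real.exp_neg, Real.sqrt_div hpi.le, Real.sqrt_div (by norm_num),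
        Real.sqrt_mul (by norm_num)]
      field_simp
    rw [remainderK, hs, besselK_eq_besselSReal hint hz, sub_eq_iff_eq_add'] at hK
    have hp : ∀ s : ℝ, ((z : ℂ) / 2) ^ (s : ℂ) = (((z / 2) ^ s : ℝ) : ℂ) := fun s => by
      rw [Complex.ofReal_cpow (by positivity)]; push_cast; rfl
    have hp' : (z : ℂ) ^ (1 / 2 : ℂ) = ((z ^ (1 / 2 : ℝ) : ℝ) : ℂ) := by
      rw [Complex.ofReal_cpow hz.le]; push_cast; rfl
    have hsq : (z : ℂ) ^ 2 / 4 = ((z ^ 2 / 4 : ℝ) : ℂ) := by push_cast; rfl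
    have hz' : (z : ℂ) ≠ 0 := by exact_mod_cast hz.ne'
    rw [← Complex.ofReal_neg, hp, hp, hp', hsq, besselS_ofReal, besselS_ofReal, hI]
    have := congrArg (fun x : ℝ => (x : ℂ)) hK
    push_cast at this ⊢
    rw [this, mul_inv_cancel_left₀ hz']
  have ht : Tendsto (fun z : ℝ => (z : ℂ)) (𝓝[≠] 1) (𝓝[≠] 1) := by
    refine tendsto_nhdsWithin_iff.2 ⟨?_, ?_⟩
    · exact (Complex.continuous_ofReal.tendsto' 1 1 (by simp)).mono_left nhdsWithin_le_nhds
    · filter_upwards [self_mem_nhdsWithin] with z hz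
      simpa using hz
  refine ht.frequently (Eventually.frequently ?_)
  filter_upwards [nhdsWithin_le_nhds (Ioi_mem_nhds one_pos)] with z hz
  exact hreal z hz

/-- The expansion, with its remainder, of `P + iQ = (πz/2)^(1/2) e^(-iω) (J_ν(z) + i Y_ν(z))`. It is
that of `K_ν` with `z` replaced by `-iz`; the Stieltjes kernel `1 / (1 + it/z)` is split into its
real and imaginary parts. -/
def hankelExpansion (N : ℕ) (z ν : ℝ) : ℂ :=
  (∑ n ∈ Finset.range N, (coeffA n ν : ℂ) * (Complex.I / z) ^ n) +
    (-1) ^ N * (reprConst ν : ℂ) * (Complex.I / z) ^ N *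
      ((kernelIntegral N (fun t => (1 + (t / z) ^ 2)⁻¹) ν : ℂ) -
        Complex.I * kernelIntegral N (fun t => t / z * (1 + (t / z) ^ 2)⁻¹) ν)

theorem evenKernel_bounds (z : ℝ) :
    (Measurable fun t : ℝ => (1 + (t / z) ^ 2)⁻¹) ∧ (∀ t, 0 < t → 0 ≤ (1 + (t / z) ^ 2)⁻¹) ∧
      ∀ t, 0 < t → (1 + (t / z) ^ 2)⁻¹ ≤ 1 :=
  ⟨by fun_prop, fun t _ => by positivity,
    fun t _ => inv_le_one_of_one_le₀ (by linarith [sq_nonneg (t / z)])⟩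

theorem oddKernel_bounds {z : ℝ} (hz : 0 < z) :
    (Measurable fun t : ℝ => t / z * (1 + (t / z) ^ 2)⁻¹) ∧
      (∀ t, 0 < t → 0 ≤ t / z * (1 + (t / z) ^ 2)⁻¹) ∧
        ∀ t, 0 < t → t / z * (1 + (t / z) ^ 2)⁻¹ ≤ 1 := by
  refine ⟨by fun_prop, fun t ht => by positivity, fun t ht => ?_⟩
  rw [← div_eq_mul_inv, div_le_one (by positivity)]
  nlinarith [sq_nonneg (t / z - 1)]

theorem continuousAt_hankelExpansion {ν z : ℝ} {N : ℕ}
    (hν : ν ∈ Ioo (-((N : ℝ) + 1 / 2)) (N + 1 / 2)) (hz : 0 < z) :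
    ContinuousAt (fun ν => hankelExpansion N z ν) ν := by
  obtain ⟨a1, a2, a3⟩ := evenKernel_bounds z
  obtain ⟨b1, b2, b3⟩ := oddKernel_bounds hz
  have hA := ((kernelIntegral_spec a1 a2 a3 N).2 ν hν).continuousAt
  have hB := ((kernelIntegral_spec b1 b2 b3 N).2 ν hν).continuousAt
  have hC : ∀ n, Continuous fun ν => coeffA n ν := fun n => by
    unfold coeffA
    fun_prop
  have hD : Continuous reprConst := by
    unfold reprConst
    fun_prop
  have hof : ∀ {f : ℝ → ℝ}, ContinuousAt f ν → ContinuousAt (fun μ => (f μ : ℂ)) ν := fun h =>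
    Complex.continuous_ofReal.continuousAt.comp h
  unfold hankelExpansion
  refine ContinuousAt.add ?_ (ContinuousAt.mul ((continuousAt_const.mul
    (hof hD.continuousAt)).mul continuousAt_const) ((hof hA).sub
      (continuousAt_const.mul (hof hB))))
  exact tendsto_finsetSum _ fun n _ => (hof (hC n).continuousAt).mul continuousAt_const

theorem stieltjes_neg_I {ν z : ℝ} {N : ℕ} (hν : ν ∈ Ioo (-((N : ℝ) + 1 / 2)) (N + 1 / 2))
    (hz : 0 < z) :
    -(Complex.I * z) * ∫ t in Ioi (0 : ℝ), ((t ^ N * weightK ν t : ℝ) : ℂ) / (-(Complex.I * z) + t)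
      = (kernelIntegral N (fun t => (1 + (t / z) ^ 2)⁻¹) ν : ℂ) -
        Complex.I * kernelIntegral N (fun t => t / z * (1 + (t / z) ^ 2)⁻¹) ν := by
  obtain ⟨a1, a2, a3⟩ := evenKernel_bounds z
  obtain ⟨b1, b2, b3⟩ := oddKernel_bounds hz
  have hA := ((kernelIntegral_spec a1 a2 a3 N).1 ν hν).1
  have hB := ((kernelIntegral_spec b1 b2 b3 N).1 ν hν).1
  rw [kernelIntegral, kernelIntegral, ← integral_complex_ofReal,
    ← integral_complex_ofReal, ← integral_const_mul,
    ← integral_const_mul, ← integral_sub hA.ofReal (hB.ofReal.const_mul _)]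
  refine setIntegral_congr_fun measurableSet_Ioi fun t ht => ?_
  simp only [mem_Ioi] at ht
  have hz' : (z : ℂ) ≠ 0 := by exact_mod_cast hz.ne'
  have h1 : -(Complex.I * z) + t ≠ 0 := fun h => by
    have := congrArg Complex.im h
    simp at this
    exact hz.ne' this
  have h2 : (1 + ((t : ℂ) / z) ^ 2) ≠ 0 := by
    exact_mod_cast (by positivity : (1 + (t / z) ^ 2) ≠ 0)
  have h3 : (z : ℂ) ^ 2 + t ^ 2 ≠ 0 := by
    exact_mod_cast (by positivity : z ^ 2 + t ^ 2 ≠ 0)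
  push_cast
  generalize (weightK ν t : ℂ) = k
  field_simp
  linear_combination (-((t : ℂ) * t ^ N * k * z)) * Complex.I_sq

theorem hankel_eq_of_not_int {ν z : ℝ} {N : ℕ} (hν : ν ∈ Ioo (-((N : ℝ) + 1 / 2)) (N + 1 / 2))
    (hint : ∀ n : ℤ, (n : ℝ) ≠ ν) (hz : 0 < z) :
    (besselJ ν z : ℂ) + Complex.I *
        (((besselJ ν z * Real.cos (Real.pi * ν) - besselJ (-ν) z) / Real.sin (Real.pi * ν) : ℝ) : ℂ)
      = Complex.exp (phase z ν * Complex.I) * Real.sqrt (2 / (Real.pi * z)) *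
        hankelExpansion N z ν := by
  set w : ℂ := -(Complex.I * z) with hw
  have hz2 : 0 < z / 2 := half_pos hz
  have hwU : w ∈ tiltedHalfPlane := by simp [tiltedHalfPlane, hw, hz]
  have hzc : (z : ℂ) ≠ 0 := by exact_mod_cast hz.ne'
  have hlog : ∀ r : ℝ, 0 < r → ∀ s : ℝ, ((r : ℂ) * -Complex.I) ^ (s : ℂ)
      = ((r ^ s : ℝ) : ℂ) * Complex.exp (-(s * (Real.pi / 2)) * Complex.I) := fun r hr s => by
    have hr' : (r : ℂ) ≠ 0 := by exact_mod_cast hr.ne'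
    rw [Complex.cpow_def_of_ne_zero (by simp [hr']), Complex.log_ofReal_mul hr (by simp),
      Complex.log_neg_I, Real.rpow_def_of_pos hr, Complex.ofReal_exp, ← Complex.exp_add]
    congr 1
    push_cast
    ring
  have main := besselS_eq_stieltjes hν hint hwU
  have e1 : w ^ (1 / 2 : ℂ) = ((z ^ (1 / 2 : ℝ) : ℝ) : ℂ) *
      Complex.exp (-(((1 / 2 : ℝ) : ℂ) * (Real.pi / 2)) * Complex.I) := by
    rw [← hlog z hz, hw]
    congr 1
    · ring
    · push_cast; rfl
  have e2 : ∀ s : ℝ, (w / 2) ^ (s : ℂ) = (((z / 2) ^ s : ℝ) : ℂ) *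
      Complex.exp (-(s * (Real.pi / 2)) * Complex.I) := fun s => by
    rw [← hlog (z / 2) hz2, hw]
    congr 1
    push_cast; ring
  have e3 : w ^ 2 / 4 = ((-(z ^ 2 / 4) : ℝ) : ℂ) := by
    rw [hw, neg_sq, mul_pow, Complex.I_sq]; push_cast; ring
  have e4 : ∀ n : ℕ, ((1 : ℂ) / w ^ n) = (Complex.I / z) ^ n := fun n => by
    rw [← one_div_pow, hw]
    congr 1
    field_simp
    simp
  have e5 : (∑ n ∈ Finset.range N, (coeffA n ν : ℂ) / w ^ n) +
      (-1) ^ N * (reprConst ν : ℂ) / w ^ N * (w * ∫ t in Ioi (0 : ℝ), ((t ^ N * weightK ν t : ℝ) : ℂ) / (w + t)) =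
      hankelExpansion N z ν := by
    rw [stieltjes_neg_I hν hz, hankelExpansion, ← e4 N]
    congr 1
    · exact Finset.sum_congr rfl fun n _ => by rw [← e4 n]; ring
    · ring
  have hJ : ∀ μ : ℝ, (((z / 2) ^ μ : ℝ) : ℂ) * (besselSReal μ (-(z ^ 2 / 4)) : ℂ) = besselJ μ z :=
    fun μ => by rw [besselJ_eq_besselSReal μ hz]; push_cast; rfl
  rw [e5, ← Complex.ofReal_neg, e1, e2, e2, e3, besselS_ofReal, besselS_ofReal] at main
  rw [← main]
  have hsin : Real.sin (Real.pi * ν) ≠ 0 := fun h => by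
    obtain ⟨n, hn⟩ := Real.sin_eq_zero_iff.1 h
    exact hint n (mul_right_cancel₀ Real.pi_ne_zero (by linarith))
  -- `J_{-ν} e^(iπν/2) - J_ν e^(-iπν/2) = i e^(iπν/2) sin(πν) (J_ν + i Y_ν)`, and the phases combine
  -- to `e^(-iω)`
  set q : ℂ := Complex.exp (-(ν * (Real.pi / 2)) * Complex.I) with hq
  have hp : Complex.exp (-(((-ν : ℝ) : ℂ) * (Real.pi / 2)) * Complex.I) * q = 1 := by
    rw [hq, ← Complex.exp_add, ← Complex.exp_zero]
    congr 1
    push_cast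
    ring
  have hqq : q * q = Real.cos (Real.pi * ν) - Real.sin (Real.pi * ν) * Complex.I := by
    rw [hq, ← Complex.exp_add,
      show -((ν : ℂ) * (Real.pi / 2)) * Complex.I + -((ν : ℂ) * (Real.pi / 2)) * Complex.I
        = -((Real.pi * ν : ℝ) : ℂ) * Complex.I by push_cast; ring,
      Complex.exp_mul_I, Complex.cos_neg, Complex.sin_neg, Complex.ofReal_cos, Complex.ofReal_sin]
    ring
  have hph : Complex.exp (phase z ν * Complex.I) *
      Complex.exp (-(((1 / 2 : ℝ) : ℂ) * (Real.pi / 2)) * Complex.I) * Complex.exp w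
      = -Complex.I * q := by
    have hI : Complex.exp (-(Real.pi / 2 : ℂ) * Complex.I) = -Complex.I := by
      rw [neg_mul, Complex.exp_neg, Complex.exp_pi_div_two_mul_I, Complex.inv_I]
    rw [← hI, hq, ← Complex.exp_add, ← Complex.exp_add, ← Complex.exp_add, hw, phase]
    congr 1
    push_cast
    ring
  have hconst : Real.sqrt (2 / (Real.pi * z)) * Real.sqrt (2 / Real.pi) * z ^ (1 / 2 : ℝ) *
      (Real.pi / (2 * Real.sin (Real.pi * ν))) = (Real.sin (Real.pi * ν))⁻¹ := by
    rw [← Real.sqrt_eq_rpow, ← Real.sqrt_mul (by positivity), ← Real.sqrt_mul (by positivity),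
      show 2 / (Real.pi * z) * (2 / Real.pi) * z = (2 / Real.pi) ^ 2 by field_simp,
      Real.sqrt_sq (by positivity)]
    field_simp
  have hconst' := congrArg (fun x : ℝ => (x : ℂ)) hconst
  simp only [Complex.ofReal_mul, Complex.ofReal_inv] at hconst'
  have hJ1 := hJ (-ν)
  have hJ2 := hJ ν
  have hsc : (Real.sin (Real.pi * ν) : ℂ) ≠ 0 := by exact_mod_cast hsin
  generalize Complex.exp (-(((-ν : ℝ) : ℂ) * (Real.pi / 2)) * Complex.I) = p at *
  generalize Complex.exp (-(((1 / 2 : ℝ) : ℂ) * (Real.pi / 2)) * Complex.I) = r at *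
  generalize Complex.exp (phase z ν * Complex.I) = x at *
  simp only [Complex.ofReal_div, Complex.ofReal_sub, Complex.ofReal_mul] at hconst' ⊢
  generalize (Real.sin (Real.pi * ν) : ℂ) = S at *
  generalize (Real.cos (Real.pi * ν) : ℂ) = C at *
  rw [← hJ1, ← hJ2]
  generalize (((z / 2) ^ ν : ℝ) : ℂ) = A at *
  generalize (((z / 2) ^ (-ν) : ℝ) : ℂ) = B at *
  generalize (besselSReal ν (-(z ^ 2 / 4)) : ℂ) = s1 at *
  generalize (besselSReal (-ν) (-(z ^ 2 / 4)) : ℂ) = s2 at *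
  trans (x * r * Complex.exp w) * (((Real.sqrt (2 / (Real.pi * z)) : ℝ) : ℂ) *
      ((Real.sqrt (2 / Real.pi) : ℝ) : ℂ) * ((z ^ (1 / 2 : ℝ) : ℝ) : ℂ) *
      ((Real.pi : ℂ) / (((2 : ℝ) : ℂ) * S))) * (B * p * s2 - A * q * s1)
  · rw [hph, hconst']
    field_simp
    linear_combination (Complex.I * B * s2) * hp - Complex.I * A * s1 * hqq
      + A * s1 * S * Complex.I_sq
  · ring

/-- The Hankel function `J_ν + i Y_ν` in terms of Stieltjes transforms of `K_ν`. At an integer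
`ν` both sides are limits from non-integer values. -/
theorem hankel_eq {ν z : ℝ} {N : ℕ} (hν : ν ∈ Ioo (-((N : ℝ) + 1 / 2)) (N + 1 / 2)) (hz : 0 < z) :
    (besselJ ν z : ℂ) + Complex.I * besselY ν z
      = Complex.exp (phase z ν * Complex.I) * Real.sqrt (2 / (Real.pi * z)) *
        hankelExpansion N z ν := by
  by_cases hint : ∃ n : ℤ, (n : ℝ) = ν
  · set G : ℝ → ℂ := fun μ => Complex.exp (phase z μ * Complex.I) *
      Real.sqrt (2 / (Real.pi * z)) * hankelExpansion N z μ with hG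
    have hGc : ContinuousAt G ν := by
      refine ContinuousAt.mul ?_ (continuousAt_hankelExpansion hν hz)
      unfold phase
      fun_prop
    obtain ⟨n, hn⟩ := hint
    have hev : ∀ᶠ μ in 𝓝[≠] ν, (besselJ μ z : ℂ) + Complex.I * (((besselJ μ z *
        Real.cos (Real.pi * μ) - besselJ (-μ) z) / Real.sin (Real.pi * μ) : ℝ) : ℂ) = G μ := by
      filter_upwards [self_mem_nhdsWithin, nhdsWithin_le_nhds (Ioo_mem_nhds hν.1 hν.2),
        nhdsWithin_le_nhds (Ioo_mem_nhds (show ν - 1 < ν by linarith)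
          (show ν < ν + 1 by linarith))] with μ h1 h2 h3
      refine hankel_eq_of_not_int h2 (fun m hm => h1 ?_) hz
      rw [← hm, ← hn] at h3
      have h4 : n - 1 < m := by exact_mod_cast h3.1
      have h5 : m < n + 1 := by exact_mod_cast h3.2
      rw [mem_singleton_iff, ← hm, ← hn, show m = n by omega]
    have hGt : Tendsto G (𝓝[≠] ν) (𝓝 (G ν)) := hGc.tendsto.mono_left nhdsWithin_le_nhds
    have hre : besselJ ν z = (G ν).re := by
      refine tendsto_nhds_unique
        (((continuous_besselJ_order hz).tendsto ν).mono_left nhdsWithin_le_nhds :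
          Tendsto _ (𝓝[≠] ν) _) ?_
      refine ((Complex.continuous_re.tendsto _).comp hGt).congr' ?_
      filter_upwards [hev] with μ hμ
      rw [Function.comp, ← hμ, Complex.add_re, Complex.I_mul_re, Complex.ofReal_im,
        Complex.ofReal_re, neg_zero, add_zero]
    have him : besselY ν z = (G ν).im := by
      rw [besselY, if_pos ⟨n, hn⟩]
      refine Tendsto.limUnder_eq (((Complex.continuous_im.tendsto _).comp hGt).congr' ?_)
      filter_upwards [hev] with μ hμ
      rw [Function.comp, ← hμ, Complex.add_im, Complex.I_mul_im, Complex.ofReal_im,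
        Complex.ofReal_re, zero_add]
    rw [hre, him]
    change _ = G ν
    rw [mul_comm, Complex.re_add_im]
  · have h := hankel_eq_of_not_int hν (fun m hm => hint ⟨m, hm⟩) hz
    rw [besselY, if_neg hint]
    exact h

theorem sum_range_two_mul_hankel (L : ℕ) (z ν : ℝ) :
    (∑ n ∈ Finset.range (2 * L), (coeffA n ν : ℂ) * (Complex.I / z) ^ n) =
      ((∑ n ∈ Finset.range L, (-1 : ℝ) ^ n * coeffA (2 * n) ν / z ^ (2 * n) : ℝ) : ℂ) +
      Complex.I * ((∑ m ∈ Finset.range L, (-1 : ℝ) ^ m * coeffA (2 * m + 1) ν / z ^ (2 * m + 1) : ℝ)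
        : ℂ) := by
  induction L with
  | zero => simp
  | succ L ih =>
    rw [show 2 * (L + 1) = 2 * L + 1 + 1 by ring, Finset.sum_range_succ, Finset.sum_range_succ, ih,
      Finset.sum_range_succ, Finset.sum_range_succ]
    have e : Complex.I ^ (2 * L) = (-1) ^ L := by rw [pow_mul, Complex.I_sq]
    rw [div_pow, div_pow, pow_succ Complex.I, e]
    push_cast
    ring

/-- The remainders `R_N^{(J)}` as integral transforms of `K_ν`. -/
theorem remainderJ_eq {ν z : ℝ} {N : ℕ} (hν : ν ∈ Ioo (-((N : ℝ) + 1 / 2)) (N + 1 / 2))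
    (hz : 0 < z) :
    remainderJ N z ν = (-1) ^ (N / 2) * reprConst ν / z ^ N *
      kernelIntegral N (fun t => (1 + (t / z) ^ 2)⁻¹) ν := by
  have h := hankel_eq hν hz
  set A := kernelIntegral N (fun t => (1 + (t / z) ^ 2)⁻¹) ν with hA
  set B := kernelIntegral N (fun t => t / z * (1 + (t / z) ^ 2)⁻¹) ν with hB
  have hs : Real.sqrt (Real.pi * z / 2) * Real.sqrt (2 / (Real.pi * z)) = 1 := by
    rw [mul_comm, sqrt_mul_sqrt_aux hz]
  have h2 : (Real.sqrt (Real.pi * z / 2) : ℂ) * Complex.exp (-(phase z ν) * Complex.I) *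
      (besselJ ν z + Complex.I * besselY ν z) = hankelExpansion N z ν := by
    rw [h]
    have hs' : (Real.sqrt (Real.pi * z / 2) : ℂ) * Real.sqrt (2 / (Real.pi * z)) = 1 := by
      exact_mod_cast hs
    have he : Complex.exp (-(phase z ν) * Complex.I) * Complex.exp (phase z ν * Complex.I) = 1 := by
      rw [← Complex.exp_add]; simp
    linear_combination hankelExpansion N z ν * hs' + (Real.sqrt (Real.pi * z / 2) : ℂ) *
      Real.sqrt (2 / (Real.pi * z)) * hankelExpansion N z ν * he
  have h3 : hankelExpansion N z ν =
      ((Real.sqrt (Real.pi * z / 2)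
        * (besselJ ν z * Real.cos (phase z ν) + besselY ν z * Real.sin (phase z ν)) : ℝ) : ℂ) +
      ((Real.sqrt (Real.pi * z / 2)
        * (besselY ν z * Real.cos (phase z ν) - besselJ ν z * Real.sin (phase z ν)) : ℝ) : ℂ)
        * Complex.I := by
    rw [← h2, Complex.exp_mul_I, Complex.cos_neg, Complex.sin_neg]
    push_cast
    linear_combination (-(Real.sqrt (Real.pi * z / 2) : ℂ) * Complex.sin (phase z ν) *
      besselY ν z) * Complex.I_sq
  rw [hankelExpansion, ← hA, ← hB] at h3
  rcases Nat.even_or_odd' N with ⟨L, rfl | rfl⟩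
  · have e : (-1 : ℂ) ^ (2 * L) * (reprConst ν : ℂ) * (Complex.I / z) ^ (2 * L) *
        ((A : ℂ) - Complex.I * B) =
        (((-1) ^ L * reprConst ν / z ^ (2 * L) * A : ℝ) : ℂ) +
        ((-((-1) ^ L * reprConst ν / z ^ (2 * L) * B) : ℝ) : ℂ) * Complex.I := by
      rw [div_pow, pow_mul Complex.I, Complex.I_sq, pow_mul (-1 : ℂ)]
      push_cast
      ring
    rw [sum_range_two_mul_hankel, e] at h3
    have h4 := congrArg Complex.re h3
    simp only [Complex.add_re, Complex.ofReal_re, Complex.mul_re, Complex.I_re, Complex.I_im,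
      Complex.ofReal_im, mul_zero, zero_mul, sub_zero, add_zero, mul_one] at h4
    rw [remainderJ, if_pos (by simp), ← h4, show 2 * L / 2 = L by omega]
    ring
  · have e : (-1 : ℂ) ^ (2 * L + 1) * (reprConst ν : ℂ) * (Complex.I / z) ^ (2 * L + 1) *
        ((A : ℂ) - Complex.I * B) =
        ((-((-1) ^ L * reprConst ν / z ^ (2 * L + 1) * B) : ℝ) : ℂ) +
        ((-((-1) ^ L * reprConst ν / z ^ (2 * L + 1) * A) : ℝ) : ℂ) * Complex.I := by
      rw [div_pow, pow_succ Complex.I, pow_mul Complex.I, Complex.I_sq, pow_succ (-1 : ℂ),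
        pow_mul (-1 : ℂ)]
      push_cast
      have : ((-1 : ℂ) ^ 2) ^ L = 1 := by simp
      rw [this]
      linear_combination ((-1) ^ L * (reprConst ν : ℂ) / z ^ (2 * L + 1) * B) * Complex.I_sq
    have e2 : (coeffA (2 * L) ν : ℂ) * (Complex.I / z) ^ (2 * L) =
        (((-1) ^ L * coeffA (2 * L) ν / z ^ (2 * L) : ℝ) : ℂ) := by
      rw [div_pow, pow_mul Complex.I, Complex.I_sq]
      push_cast
      ring
    rw [Finset.sum_range_succ, sum_range_two_mul_hankel, e, e2] at h3
    have h4 := congrArg Complex.im h3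
    simp only [Complex.add_im, Complex.ofReal_re, Complex.mul_im, Complex.I_re, Complex.I_im,
      Complex.ofReal_im, mul_zero, add_zero, zero_add, mul_one, one_mul] at h4
    rw [remainderJ, if_neg (by simp), ← h4, show (2 * L + 1) / 2 = L by omega]
    ring

/-! ### Terminants of integer order and the re-expansion -/

theorem norm_le_norm_add {w : ℂ} (hw : 0 ≤ w.re) {s : ℝ} (hs : 0 ≤ s) : ‖w‖ ≤ ‖w + s‖ := by
  rw [Complex.norm_def, Complex.norm_def]
  apply Real.sqrt_le_sqrt
  simp only [Complex.normSq_apply, Complex.add_re, Complex.add_im, Complex.ofReal_re,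
    Complex.ofReal_im, add_zero]
  nlinarith [mul_nonneg hw hs]

theorem add_ofReal_ne_zero {w : ℂ} (hw : 0 ≤ w.re) (hw0 : w ≠ 0) {s : ℝ} (hs : 0 ≤ s) :
    w + s ≠ 0 :=
  norm_pos_iff.1 ((norm_pos_iff.2 hw0).trans_le (norm_le_norm_add hw hs))

theorem integrableOn_exp_neg_div_pow {w : ℂ} (hw : 0 ≤ w.re) (hw0 : w ≠ 0) (p : ℕ) :
    IntegrableOn (fun s : ℝ => Complex.exp (-s) / (w + s) ^ p) (Ioi 0) := by
  have h : IntegrableOn (fun s : ℝ => Real.exp (-s) * (‖w‖ ^ p)⁻¹) (Ioi 0) :=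
    (exp_neg_integrableOn_Ioi 0 one_pos |>.congr_fun (fun s _ => by simp)
      measurableSet_Ioi).mul_const _
  refine Integrable.mono' h
    (by fun_prop : Measurable fun s : ℝ => Complex.exp (-s) / (w + s) ^ p).aestronglyMeasurable ?_
  refine (ae_restrict_iff' measurableSet_Ioi).2 (Eventually.of_forall fun s hs => ?_)
  rw [norm_div, Complex.norm_exp, norm_pow, div_eq_mul_inv]
  simp only [Complex.neg_re, Complex.ofReal_re]
  gcongr
  exact norm_le_norm_add hw (le_of_lt hs)

theorem integral_exp_neg_div_pow_add {w : ℂ} (hw : 0 ≤ w.re) (hw0 : w ≠ 0) (p : ℕ) :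
    (∫ s in Ioi (0 : ℝ), Complex.exp (-s) / (w + s) ^ p) +
      p * ∫ s in Ioi (0 : ℝ), Complex.exp (-s) / (w + s) ^ (p + 1) = 1 / w ^ p := by
  have hi1 := integrableOn_exp_neg_div_pow hw hw0 p
  have hi2 := (integrableOn_exp_neg_div_pow hw hw0 (p + 1)).const_mul (p : ℂ)
  have hd : ∀ s ∈ Ici (0 : ℝ), HasDerivAt (fun s : ℝ => -(Complex.exp (-s) / (w + s) ^ p))
      (Complex.exp (-s) / (w + s) ^ p + p * (Complex.exp (-s) / (w + s) ^ (p + 1))) s := by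
    intro s hs
    have h0 := add_ofReal_ne_zero hw hw0 hs
    have hs1 : HasDerivAt (fun s : ℝ => (s : ℂ)) 1 s := Complex.ofRealCLM.hasDerivAt
    have h := ((hs1.neg.cexp).div ((hs1.const_add w).pow p) (pow_ne_zero p h0)).neg
    refine h.congr_deriv ?_
    simp only [Pi.pow_apply, Pi.neg_apply]
    -- `p - 1` in the derivative of the power is truncated at `p = 0`
    rcases p with _ | p
    · simp
    · simp only [Nat.add_sub_cancel]
      field_simp
      ring
  have ht : Tendsto (fun s : ℝ => -(Complex.exp (-s) / (w + s) ^ p)) atTop (𝓝 0) := by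
    rw [tendsto_zero_iff_norm_tendsto_zero]
    have hb : Tendsto (fun s : ℝ => Real.exp (-s) * (‖w‖ ^ p)⁻¹) atTop (𝓝 0) := by
      simpa using (Real.tendsto_exp_neg_atTop_nhds_zero).mul_const (‖w‖ ^ p)⁻¹
    refine squeeze_zero' (Eventually.of_forall fun s => norm_nonneg _) ?_ hb
    filter_upwards [eventually_ge_atTop 0] with s hs
    rw [norm_neg, norm_div, Complex.norm_exp, norm_pow, div_eq_mul_inv]
    simp only [Complex.neg_re, Complex.ofReal_re]
    gcongr
    exact norm_le_norm_add hw hs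
  have key := integral_Ioi_of_hasDerivAt_of_tendsto' hd (hi1.add hi2) ht
  rw [integral_add hi1 hi2, integral_const_mul] at key
  rw [key]
  simp

theorem integrableOn_pow_mul_exp_div {w : ℂ} (hw : 0 ≤ w.re) (hw0 : w ≠ 0) (q : ℕ) :
    IntegrableOn (fun t : ℝ => (t : ℂ) ^ q * Complex.exp (-t) / (w + t)) (Ioi 0) := by
  have h0 := (hasInt_Gamma (p := (q : ℝ) + 1) (by positivity) one_pos).1
  have h := h0.mul_const ‖w‖⁻¹
  refine Integrable.mono' h (by fun_prop : Measurable fun t : ℝ =>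
    (t : ℂ) ^ q * Complex.exp (-t) / (w + t)).aestronglyMeasurable ?_
  refine (ae_restrict_iff' measurableSet_Ioi).2 (Eventually.of_forall fun t ht => ?_)
  simp only [mem_Ioi] at ht
  rw [norm_div, norm_mul, Complex.norm_exp, norm_pow, div_eq_mul_inv, Complex.norm_real,
    Real.norm_of_nonneg ht.le, add_sub_cancel_right, Real.rpow_natCast, one_mul]
  simp only [Complex.neg_re, Complex.ofReal_re]
  gcongr
  exact norm_le_norm_add hw ht.le

theorem integral_pow_mul_exp_complex (q : ℕ) :
    IntegrableOn (fun t : ℝ => (t : ℂ) ^ q * Complex.exp (-t)) (Ioi 0) ∧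
      ∫ t in Ioi (0 : ℝ), (t : ℂ) ^ q * Complex.exp (-t) = q.factorial := by
  have h := (hasInt_Gamma (p := (q : ℝ) + 1) (by positivity) one_pos)
  have e : ∀ t : ℝ, (t : ℂ) ^ q * Complex.exp (-t) =
      ((t ^ ((q : ℝ) + 1 - 1) * Real.exp (-(1 * t)) : ℝ) : ℂ) := fun t => by
    rw [add_sub_cancel_right, Real.rpow_natCast, one_mul]
    push_cast
    rfl
  simp only [e]
  refine ⟨h.1.ofReal, ?_⟩
  rw [integral_complex_ofReal, h.2, Real.one_rpow, div_one, Real.Gamma_nat_eq_factorial]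
  simp

/-- The two integrals for the terminant of integer order agree: both satisfy the same recurrence
in the order, by an integration by parts and by division with remainder, respectively. -/
theorem factorial_mul_integral_exp_neg {w : ℂ} (hw : 0 ≤ w.re) (hw0 : w ≠ 0) (q : ℕ) :
    q.factorial * w ^ (q + 1) * ∫ s in Ioi (0 : ℝ), Complex.exp (-s) / (w + s) ^ (q + 1) =
      w * ∫ t in Ioi (0 : ℝ), (t : ℂ) ^ q * Complex.exp (-t) / (w + t) := by
  induction q with
  | zero => simp
  | succ q ih =>
    have h1 := integral_exp_neg_div_pow_add hw hw0 (q + 1)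
    have h2 : (∫ t in Ioi (0 : ℝ), (t : ℂ) ^ (q + 1) * Complex.exp (-t) / (w + t)) =
        q.factorial - w * ∫ t in Ioi (0 : ℝ), (t : ℂ) ^ q * Complex.exp (-t) / (w + t) := by
      obtain ⟨hi, hv⟩ := integral_pow_mul_exp_complex q
      rw [← hv, ← integral_const_mul, ← integral_sub hi
        ((integrableOn_pow_mul_exp_div hw hw0 q).const_mul w)]
      refine setIntegral_congr_fun measurableSet_Ioi fun t ht => ?_
      have h0 := add_ofReal_ne_zero hw hw0 (le_of_lt ht)
      field_simp
      ring
    rw [h2, ← ih, Nat.factorial_succ]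
    have h3 : w ^ (q + 1) * (1 / w ^ (q + 1)) = 1 := by
      rw [mul_one_div_cancel (pow_ne_zero _ hw0)]
    push_cast at h1 ⊢
    linear_combination (q.factorial * w ^ (q + 2)) * h1 + (q.factorial * w) * h3

theorem factorial_mul_terminantLambda {w : ℂ} (hw : 0 ≤ w.re) (hw0 : w ≠ 0) (q : ℕ) :
    q.factorial * terminantLambda ((q + 1 : ℕ) : ℂ) w =
      w * ∫ t in Ioi (0 : ℝ), (t : ℂ) ^ q * Complex.exp (-t) / (w + t) := by
  rw [← factorial_mul_integral_exp_neg hw hw0, terminantLambda, incompleteGamma,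
    Complex.cpow_natCast, mul_assoc, mul_assoc, ← integral_const_mul]
  congr 2
  refine setIntegral_congr_fun measurableSet_Ioi fun s _ => ?_
  rw [sub_sub_cancel_left, Complex.cpow_neg, Complex.cpow_natCast, neg_add, Complex.exp_add,
    Complex.exp_neg w]
  field_simp

/-- The integral `∫_0^∞ t^q e^(-2t) κ(t) dt`, to which the terminants reduce. -/
def terminantIntegral (q : ℕ) (κ : ℝ → ℝ) : ℝ :=
  ∫ t in Ioi (0 : ℝ), t ^ q * Real.exp (-(2 * t)) * κ t

theorem hasInt_terminantIntegral (q : ℕ) {κ : ℝ → ℝ} (hκ : Measurable κ)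
    (hκ0 : ∀ t, 0 < t → 0 ≤ κ t) (hκ1 : ∀ t, 0 < t → κ t ≤ 1) :
    HasInt (Ioi 0) (fun t => t ^ q * Real.exp (-(2 * t)) * κ t) (terminantIntegral q κ) := by
  have h := (hasInt_Gamma (p := (q : ℝ) + 1) (b := 2) (by positivity) two_pos).1
  refine ⟨Integrable.mono' h (Measurable.aestronglyMeasurable (by fun_prop)) ?_, rfl⟩
  refine (ae_restrict_iff' measurableSet_Ioi).2 (Eventually.of_forall fun t ht => ?_)
  simp only [mem_Ioi] at ht
  have h0 := hκ0 t ht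
  rw [Real.norm_of_nonneg (by positivity), add_sub_cancel_right, Real.rpow_natCast]
  exact mul_le_of_le_one_right (by positivity) (hκ1 t ht)

theorem integral_rescale_two (q : ℕ) (F : ℝ → ℝ) :
    ∫ t in Ioi (0 : ℝ), t ^ q * Real.exp (-t) * F t =
      2 ^ (q + 1) * terminantIntegral q fun t => F (2 * t) := by
  have h := integral_comp_mul_left_Ioi (fun t => t ^ q * Real.exp (-t) * F t) 0 two_pos
  rw [mul_zero, smul_eq_mul, inv_mul_eq_div, eq_div_iff (by norm_num)] at h
  rw [← h, terminantIntegral, mul_comm, ← integral_const_mul, ← integral_const_mul]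
  congr 1
  ext t
  rw [mul_pow]
  ring

theorem factorial_mul_terminantLambda_two_mul {z : ℝ} (hz : 0 < z) (q : ℕ) :
    q.factorial * terminantLambda ((q + 1 : ℕ) : ℂ) (2 * z) =
      ((2 ^ (q + 1) * terminantIntegral q fun t => (1 + t / z)⁻¹ : ℝ) : ℂ) := by
  have hw : (0 : ℝ) ≤ (2 * (z : ℂ)).re := by simp [hz.le]
  have hw0 : (2 * (z : ℂ)) ≠ 0 := by simp [hz.ne']
  have e : (fun t : ℝ => (1 + t / z)⁻¹) = fun t => (1 + 2 * t / (2 * z))⁻¹ := by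
    ext t; rw [mul_div_mul_left _ _ two_ne_zero]
  rw [factorial_mul_terminantLambda hw hw0, e,
    ← integral_rescale_two q fun t => (1 + t / (2 * z))⁻¹, ← integral_const_mul,
    ← integral_complex_ofReal]
  refine setIntegral_congr_fun measurableSet_Ioi fun t ht => ?_
  have hz' : (z : ℂ) ≠ 0 := by exact_mod_cast hz.ne'
  push_cast
  field_simp

theorem factorial_mul_terminantPi_two_mul {z : ℝ} (hz : 0 < z) (q : ℕ) :
    q.factorial * terminantPi ((q + 1 : ℕ) : ℂ) (2 * z) =
      ((2 ^ (q + 1) * terminantIntegral q fun t => (1 + (t / z) ^ 2)⁻¹ : ℝ) : ℂ) := by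
  have hw1 : (0 : ℝ) ≤ (2 * (z : ℂ) * Complex.I).re := by simp
  have hw10 : (2 * (z : ℂ) * Complex.I) ≠ 0 := by simp [hz.ne']
  have hw2 : (0 : ℝ) ≤ (2 * (z : ℂ) * -Complex.I).re := by simp
  have hw20 : (2 * (z : ℂ) * -Complex.I) ≠ 0 := by simp [hz.ne']
  have e : (fun t : ℝ => (1 + (t / z) ^ 2)⁻¹) = fun t => (1 + (2 * t / (2 * z)) ^ 2)⁻¹ := by
    ext t; rw [mul_div_mul_left _ _ two_ne_zero]
  rw [terminantPi, mul_div_assoc', mul_add, factorial_mul_terminantLambda hw1 hw10,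
    factorial_mul_terminantLambda hw2 hw20, e,
    ← integral_rescale_two q fun t => (1 + (t / (2 * z)) ^ 2)⁻¹, ← integral_const_mul,
    ← integral_const_mul, ← integral_add
      ((integrableOn_pow_mul_exp_div hw1 hw10 q).const_mul _)
      ((integrableOn_pow_mul_exp_div hw2 hw20 q).const_mul _), div_eq_inv_mul,
    ← integral_const_mul, ← integral_complex_ofReal]
  refine setIntegral_congr_fun measurableSet_Ioi fun t ht => ?_
  have h1 := add_ofReal_ne_zero hw1 hw10 (le_of_lt ht)
  have h2 := add_ofReal_ne_zero hw2 hw20 (le_of_lt ht)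
  have hz' : (z : ℂ) ≠ 0 := by exact_mod_cast hz.ne'
  have h3 : (2 * (z : ℂ)) ^ 2 + t ^ 2 ≠ 0 := by
    exact_mod_cast (by positivity : (2 * z) ^ 2 + t ^ 2 ≠ 0)
  have h5 : (1 + ((t : ℂ) / (2 * z)) ^ 2)⁻¹ = (2 * (z : ℂ)) ^ 2 / ((2 * (z : ℂ)) ^ 2 + t ^ 2) := by
    rw [div_pow]
    field_simp
  have h6 : (2 * (z : ℂ)) ^ 2 + t ^ 2 =
      (2 * (z : ℂ) * Complex.I + t) * (2 * (z : ℂ) * -Complex.I + t) := by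
    linear_combination ((2 * (z : ℂ)) ^ 2) * Complex.I_sq
  push_cast
  rw [h5, h6]
  generalize Complex.exp (-(t : ℂ)) = E
  rw [← mul_div_assoc, ← mul_div_assoc, ← mul_div_assoc, div_add_div _ _ h1 h2, ← mul_div_assoc]
  congr 1
  linear_combination (-(4 : ℂ) * z ^ 2 * t ^ q * E) * Complex.I_sq

theorem termK_eq {N m : ℕ} {z ν : ℝ} (hz : 0 < z) (hm : m < N) :
    termK N m z ν = (((-1 : ℝ) ^ N / z ^ N * (Real.cos (Real.pi * ν) / Real.pi) *
      (coeffA m ν * terminantIntegral (N - m - 1) fun t => (1 + t / z)⁻¹) : ℝ) : ℂ) := by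
  obtain ⟨k, rfl⟩ := Nat.exists_eq_add_of_lt hm
  have h := factorial_mul_terminantLambda_two_mul hz k
  have e1 : ((m + k + 1 : ℕ) : ℝ) - m = k + 1 := by push_cast; ring
  have e2 : ((m + k + 1 : ℕ) : ℂ) - m = ((k + 1 : ℕ) : ℂ) := by push_cast; ring
  rw [termK, e1, e2, Real.Gamma_nat_eq_factorial, show m + k + 1 - m - 1 = k by omega]
  generalize terminantIntegral k _ = x at h ⊢
  generalize terminantLambda _ _ = y at h ⊢
  generalize (-1 : ℝ) ^ _ = σ
  have hz' : (z : ℂ) ≠ 0 := by exact_mod_cast hz.ne'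
  push_cast at h ⊢
  rw [show (2 : ℂ) ^ (m + k + 1) = 2 ^ m * 2 ^ (k + 1) by ring]
  field_simp
  linear_combination ((σ : ℂ) * Complex.cos (Real.pi * ν) * coeffA m ν) * h

theorem termJ_eq {N m : ℕ} {z ν : ℝ} (hz : 0 < z) (hm : m < N) :
    termJ N m z ν = (((-1 : ℝ) ^ (N / 2) / z ^ N * (Real.cos (Real.pi * ν) / Real.pi) *
      (coeffA m ν * terminantIntegral (N - m - 1) fun t => (1 + (t / z) ^ 2)⁻¹) : ℝ) : ℂ) := by
  obtain ⟨k, rfl⟩ := Nat.exists_eq_add_of_lt hm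
  have h := factorial_mul_terminantPi_two_mul hz k
  have e1 : ((m + k + 1 : ℕ) : ℝ) - m = k + 1 := by push_cast; ring
  have e2 : ((m + k + 1 : ℕ) : ℂ) - m = ((k + 1 : ℕ) : ℂ) := by push_cast; ring
  rw [termJ, e1, e2, Real.Gamma_nat_eq_factorial, show m + k + 1 - m - 1 = k by omega]
  generalize terminantIntegral k _ = x at h ⊢
  generalize terminantPi _ _ = y at h ⊢
  generalize (-1 : ℝ) ^ _ = σ
  have hz' : (z : ℂ) ≠ 0 := by exact_mod_cast hz.ne'
  push_cast at h ⊢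
  rw [show (2 : ℂ) ^ (m + k + 1) = 2 ^ m * 2 ^ (k + 1) by ring]
  field_simp
  linear_combination ((σ : ℂ) * Complex.cos (Real.pi * ν) * coeffA m ν) * h

theorem HasInt.pos {F : ℝ → ℝ} {c : ℝ} (h : HasInt (Ioi 0) F c) (hF : ∀ t, 0 < t → 0 < F t) :
    0 < c := by
  rw [← h.2, setIntegral_pos_iff_support_of_nonneg_ae ?_ h.1]
  · have : Ioi (0 : ℝ) ⊆ Function.support F ∩ Ioi 0 :=
      fun t ht => ⟨(hF t ht).ne', ht⟩
    refine lt_of_lt_of_le ?_ (measure_mono this)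
    simp
  · exact (ae_restrict_iff' measurableSet_Ioi).2 (Eventually.of_forall fun t ht => (hF t ht).le)

/-- The remainder `R_M^{(K)}` has the sign of the first omitted term and is smaller: in the
Stieltjes representation the kernel `(1 + s/t)⁻¹` lies strictly between `0` and `1`, and without
it the integral is `a_M(ν)`. -/
theorem exists_remainderK_eq {ν t : ℝ} {M : ℕ} (hν : ν ∈ Ioo (-((M : ℝ) + 1 / 2)) (M + 1 / 2))
    (ht : 0 < t) : ∃ θ, 0 < θ ∧ θ < 1 ∧ remainderK M t ν = coeffA M ν / t ^ M * θ := by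
  obtain ⟨a1, a2, a3⟩ := stieltjesKernel_bounds ht
  have h1 := (kernelIntegral_spec a1 a2 a3 M).1 ν hν
  have h2 := hasInt_moment hν
  have hw : ∀ s, 0 < s → 0 < s ^ M * weightK ν s := fun s hs => by
    have := weightK_pos ν hs
    positivity
  have p1 : 0 < kernelIntegral M (fun s => (1 + s / t)⁻¹) ν := h1.pos fun s hs => by
    have := hw s hs
    positivity
  have p2 : 0 < kernelIntegral M (fun _ => 1) ν - kernelIntegral M (fun s => (1 + s / t)⁻¹) ν := by
    refine (h2.sub h1).pos fun s hs => sub_pos.2 (mul_lt_of_lt_one_right (hw s hs) ?_)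
    refine inv_lt_one_of_one_lt₀ ?_
    have : 0 < s / t := by positivity
    linarith
  have p3 : 0 < kernelIntegral M (fun _ => 1) ν := by linarith
  refine ⟨_, div_pos p1 p3, (div_lt_one p3).2 (by linarith), ?_⟩
  rw [remainderK_eq hν ht, coeffA_eq_moment hν]
  field_simp

theorem sqrt_mul_weightK {ν t : ℝ} (ht : 0 < t) (M : ℕ) :
    Real.sqrt (2 / Real.pi) * weightK ν t = t⁻¹ * Real.exp (-(2 * t)) *
      ((∑ m ∈ Finset.range M, coeffA m ν / t ^ m) + remainderK M t ν) := by
  have hpi := Real.pi_pos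
  rw [weightK, besselK_eq M ht ν, Real.rpow_neg ht.le, ← Real.sqrt_eq_rpow,
    show -(2 * t) = -t + -t by ring, Real.exp_add, Real.sqrt_div (by norm_num),
    Real.sqrt_div hpi.le, Real.sqrt_mul (by norm_num)]
  have h2 : Real.sqrt 2 ≠ 0 := by positivity
  have h3 : Real.sqrt Real.pi ≠ 0 := by positivity
  have h5 : Real.sqrt t ≠ 0 := by positivity
  field_simp
  rw [Real.sq_sqrt ht.le]

/-- The re-expansion: inserting the expansion of `K_ν` into an integral `kernelIntegral` leaves a
remainder which is an average of the remainders of `K_ν`, with a positive weight. -/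
theorem exists_reexpansion {κ : ℝ → ℝ} (hκ : Measurable κ) (hκ0 : ∀ t, 0 < t → 0 < κ t)
    (hκ1 : ∀ t, 0 < t → κ t ≤ 1) {ν : ℝ} {N M : ℕ} (hMN : M < N)
    (hν : ν ∈ Ioo (-((M : ℝ) + 1 / 2)) (M + 1 / 2)) :
    ∃ Θ, 0 < Θ ∧ Θ < 1 ∧
      Real.sqrt (2 / Real.pi) * kernelIntegral N κ ν
        - ∑ m ∈ Finset.range M, coeffA m ν * terminantIntegral (N - m - 1) κ =
      coeffA M ν * terminantIntegral (N - M - 1) κ * Θ := by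
  have hκ0' : ∀ t, 0 < t → 0 ≤ κ t := fun t ht => (hκ0 t ht).le
  have hNM : (M : ℝ) < N := by exact_mod_cast hMN
  have hν' : ν ∈ Ioo (-((N : ℝ) + 1 / 2)) (N + 1 / 2) :=
    ⟨by linarith [hν.1], by linarith [hν.2]⟩
  choose! θ hθ0 hθ1 hθ using fun t (ht : 0 < t) => exists_remainderK_eq hν ht
  set h : ℝ → ℝ := fun t => t ^ (N - M - 1) * Real.exp (-(2 * t)) * κ t with hh
  have hint : HasInt (Ioi 0) h (terminantIntegral (N - M - 1) κ) :=
    hasInt_terminantIntegral _ hκ hκ0' hκ1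
  have hpos : ∀ t, 0 < t → 0 < h t := fun t ht => by
    have := hκ0 t ht
    positivity
  have hdiff := (((kernelIntegral_spec hκ hκ0' hκ1 N).1 ν hν').const_mul
    (Real.sqrt (2 / Real.pi))).sub (HasInt.sum (Finset.range M) fun m _ =>
      (hasInt_terminantIntegral (N - m - 1) hκ hκ0' hκ1).const_mul (coeffA m ν))
  have hdiff' := hdiff.congr (G := fun t => coeffA M ν * (h t * θ t)) measurableSet_Ioi
    (fun t ht => ?_) rfl
  -- if `a_M(ν) = 0`, both sides vanish and any `Θ` will do
  · by_cases hA : coeffA M ν = 0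
    · refine ⟨1 / 2, by norm_num, by norm_num, ?_⟩
      rw [← hdiff'.2, hA]
      simp
    · have hθi := (hdiff'.const_mul (coeffA M ν)⁻¹).congr (G := fun t => h t * θ t)
        measurableSet_Ioi (fun t _ => inv_mul_cancel_left₀ hA _) rfl
      have p1 := hθi.pos fun t ht => mul_pos (hpos t ht) (hθ0 t ht)
      have p2 := (hint.sub hθi).pos fun t ht =>
        sub_pos.2 (mul_lt_of_lt_one_right (hpos t ht) (hθ1 t ht))
      have p3 := hint.pos hpos
      refine ⟨_, div_pos p1 p3, (div_lt_one p3).2 (by linarith), ?_⟩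
      field_simp
  · simp only [mem_Ioi] at ht
    have e : ∀ m, m < N → t ^ N * t⁻¹ / t ^ m = t ^ (N - m - 1) := fun m hm => by
      obtain ⟨k, rfl⟩ := Nat.exists_eq_add_of_lt hm
      rw [show m + k + 1 - m - 1 = k by omega]
      field_simp
      ring
    have h1 : Real.sqrt (2 / Real.pi) * (t ^ N * weightK ν t * κ t) =
        t ^ N * κ t * (Real.sqrt (2 / Real.pi) * weightK ν t) := by ring
    rw [h1, sqrt_mul_weightK ht M, hθ t ht, hh]
    dsimp only
    rw [← e M hMN, mul_add, mul_add, Finset.mul_sum, Finset.mul_sum, add_sub_right_comm,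
      ← Finset.sum_sub_distrib, Finset.sum_eq_zero fun m hm => ?_]
    · ring
    · rw [← e m ((Finset.mem_range.1 hm).trans hMN)]
      ring

end BesselReexpansion

end

open BesselReexpansion in
theorem theorem12 (N M : ℕ) (hMN : M < N) (z ν : ℝ) (hz : 0 < z) (hν : |ν| < (M : ℝ) + 1 / 2) :
    (∃ Θ : ℝ, 0 < Θ ∧ Θ < 1 ∧
      BesselReexpansion.reexpRemainderK N M z ν =
        (((-1 : ℝ) ^ N * (Real.cos (Real.pi * ν) / (2 ^ N * Real.pi)) * (1 / z ^ N)
            * (2 ^ M * BesselReexpansion.coeffA M ν * Real.Gamma ((N : ℝ) - M)) : ℝ) : ℂ)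
          * BesselReexpansion.terminantLambda ((N : ℂ) - M) (2 * (z : ℂ)) * (Θ : ℂ)) ∧
    (∃ Θ : ℝ, 0 < Θ ∧ Θ < 1 ∧
      BesselReexpansion.reexpRemainderJ N M z ν =
        (((-1 : ℝ) ^ (N / 2) * (Real.cos (Real.pi * ν) / (2 ^ N * Real.pi)) * (1 / z ^ N)
            * (2 ^ M * BesselReexpansion.coeffA M ν * Real.Gamma ((N : ℝ) - M)) : ℝ) : ℂ)
          * BesselReexpansion.terminantPi ((N : ℂ) - M) (2 * (z : ℂ)) * (Θ : ℂ)) := by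
  have hν1 : ν ∈ Set.Ioo (-((M : ℝ) + 1 / 2)) (M + 1 / 2) := abs_lt.1 hν
  have hNM : (M : ℝ) < N := by exact_mod_cast hMN
  have hν2 : ν ∈ Set.Ioo (-((N : ℝ) + 1 / 2)) (N + 1 / 2) :=
    ⟨by linarith [hν1.1], by linarith [hν1.2]⟩
  constructor
  · obtain ⟨a1, a2, a3⟩ := stieltjesKernel_bounds hz
    obtain ⟨Θ, h0, h1, h⟩ := exists_reexpansion a1 (fun t ht => by positivity) a3 hMN hν1
    refine ⟨Θ, h0, h1, ?_⟩
    have hterm : ∀ m, m < N → termK N m z ν = (((-1 : ℝ) ^ N / z ^ N *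
        (Real.cos (Real.pi * ν) / Real.pi) *
        (coeffA m ν * terminantIntegral (N - m - 1) fun t => (1 + t / z)⁻¹) : ℝ) : ℂ) :=
      fun m hm => termK_eq hz hm
    change _ = termK N M z ν * (Θ : ℂ)
    rw [reexpRemainderK, hterm M hMN,
      Finset.sum_congr rfl fun m hm => hterm m ((Finset.mem_range.1 hm).trans hMN),
      remainderK_eq hν2 hz, reprConst, ← Complex.ofReal_sum, ← Finset.mul_sum,
      ← Complex.ofReal_sub, ← Complex.ofReal_mul]
    congr 1
    linear_combination ((-1 : ℝ) ^ N / z ^ N * (Real.cos (Real.pi * ν) / Real.pi)) * h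
  · obtain ⟨a1, a2, a3⟩ := evenKernel_bounds z
    obtain ⟨Θ, h0, h1, h⟩ := exists_reexpansion a1 (fun t ht => by positivity) a3 hMN hν1
    refine ⟨Θ, h0, h1, ?_⟩
    have hterm : ∀ m, m < N → termJ N m z ν = (((-1 : ℝ) ^ (N / 2) / z ^ N *
        (Real.cos (Real.pi * ν) / Real.pi) *
        (coeffA m ν * terminantIntegral (N - m - 1) fun t => (1 + (t / z) ^ 2)⁻¹) : ℝ) : ℂ) :=
      fun m hm => termJ_eq hz hm
    change _ = termJ N M z ν * (Θ : ℂ)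
    rw [reexpRemainderJ, hterm M hMN,
      Finset.sum_congr rfl fun m hm => hterm m ((Finset.mem_range.1 hm).trans hMN),
      remainderJ_eq hν2 hz, reprConst, ← Complex.ofReal_sum, ← Finset.mul_sum,
      ← Complex.ofReal_sub, ← Complex.ofReal_mul]
    congr 1
    linear_combination ((-1 : ℝ) ^ (N / 2) / z ^ N * (Real.cos (Real.pi * ν) / Real.pi)) * h
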